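/- Let $p$ be a prime, $K/\mathbb{Q}_p$ a finite extension with valuation ring $\mathcal{O}$, and $\pi\in\mathcal{O}$ a uniformiser. Let $\mathfrak{g}$ be a finite-dimensional nilpotent Lie algebra over $K$ and let $\mathcal{L}$ be an $\mathcal{O}$-Lie lattice in $\mathfrak{g}$, i.e. an $\mathcal{O}$-submodule closed under the Lie bracket, with $\bigcap_{n}\pi^n\mathcal{L}=0$ and $\mathcal{L}\otimes_{\mathcal{O}}K=\mathfrak{g}$. For an $\mathcal{O}$-Lie algebra $\mathcal{M}$ write $\widehat{U(\mathcal{M})}=\varprojlim_n U(\mathcal{M})/\pi^nU(\mathcal{M})$ for the $\pi$-adic completion of its enveloping algebra, and $\widehat{U(\mathcal{M})}_K=\widehat{U(\mathcal{M})}\otimes_{\mathcal{O}}K$. For $\lambda\in\mathfrak{g}^*=\mathrm{Hom}_K(\mathfrak{g},K)$, a polarisation of $\mathfrak{g}$ at $\lambda$ is a solvable Lie subalgebra $\mathfrak{b}\subseteq\mathfrak{g}$ such that, for all $u\in\mathfrak{g}$, $\lambda([u,\mathfrak{b}])=0$ if and only if $u\in\mathfrak{b}$. If $\lambda(\mathcal{L})\subseteq\mathcal{O}$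 and $\mathfrak{b}$ is a polarisation of $\mathfrak{g}$ at $\lambda$, put $\mathcal{B}=\mathfrak{b}\cap\mathcal{L}$; the character $\lambda|_{\mathcal{B}}:\mathcal{B}\to\mathcal{O}$ extends to a homomorphism $U(\mathcal{B})\to\mathcal{O}$, and hence, by continuity and $K$-linearity, to $\widehat{U(\mathcal{B})}_K\to K$, which makes the one-dimensional space $K_\lambda=K$ a $\widehat{U(\mathcal{B})}_K$-module. The affinoid Dixmier module is the $\widehat{U(\mathcal{L})}_K$-module $$\widehat{D(\lambda)}_{\mathfrak{b}}=\widehat{U(\mathcal{L})}_K\otimes_{\widehat{U(\mathcal{B})}_K}K_\lambda .$$ Theorem. For every $\lambda\in\mathfrak{g}^*$ with $\lambda(\mathcal{L})\subseteq\mathcal{O}$ there exists a polarisation $\mathfrak{b}$ of $\mathfrak{g}$ at $\lambda$ such that $\widehat{D(\lambda)}_{\mathfrak{b}}$ is an irreducible $\widehat{U(\mathcal{L})}_K$-module. -/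

import Mathlib

open scoped TensorProduct

attribute [local instance 100] LieRing.ofAssociativeRing

noncomputable section

namespace AffinoidDixmier

/-! ### Completions of (non-commutative) algebras -/

section Completion

variable {O : Type*} [CommRing O] (π : O)

/-- The ideal `π ^ n A` of an `O`-algebra `A`. -/
def powIdeal (A : Type*) [Ring A] [Algebra O A] (n : ℕ) : Ideal A :=
  Ideal.span {algebraMap O A (π ^ n)}

theorem mem_powIdeal {A : Type*} [Ring A] [Algebra O A] {n : ℕ} {a : A} :
    a ∈ powIdeal π A n ↔ ∃ b : A, a = π ^ n • b := by
  rw [powIdeal, Ideal.mem_span_singleton']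
  constructor
  · rintro ⟨b, rfl⟩
    exact ⟨b, by rw [Algebra.smul_def, Algebra.commutes]⟩
  · rintro ⟨b, rfl⟩
    exact ⟨b, by rw [Algebra.smul_def, Algebra.commutes]⟩

instance powIdeal_isTwoSided (A : Type*) [Ring A] [Algebra O A] (n : ℕ) :
    (powIdeal π A n).IsTwoSided where
  mul_mem_of_left {a} b ha := by
    rw [mem_powIdeal] at ha ⊢
    obtain ⟨c, rfl⟩ := ha
    exact ⟨c * b, by rw [smul_mul_assoc]⟩

theorem powIdeal_anti (A : Type*) [Ring A] [Algebra O A] {m n : ℕ} (h : m ≤ n) :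
    powIdeal π A n ≤ powIdeal π A m := by
  intro a ha
  rw [mem_powIdeal] at ha ⊢
  obtain ⟨c, rfl⟩ := ha
  exact ⟨π ^ (n - m) • c, by rw [smul_smul, ← pow_add, Nat.add_sub_cancel' h]⟩

/-- The `π`-adic completion `lim A / π ^ n A` of an `O`-algebra `A`, realised as the algebra of
compatible sequences in the product of the quotients. -/
def completion (A : Type*) [Ring A] [Algebra O A] :
    Subalgebra O (∀ n : ℕ, A ⧸ powIdeal π A n) where
  carrier := {x | ∀ ⦃m n : ℕ⦄ (h : m ≤ n),
    Ideal.Quotient.factorₐ O (powIdeal_anti π A h) (x n) = x m}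
  mul_mem' hx hy m n h := by rw [Pi.mul_apply, map_mul, hx h, hy h, Pi.mul_apply]
  add_mem' hx hy m n h := by rw [Pi.add_apply, map_add, hx h, hy h, Pi.add_apply]
  algebraMap_mem' r m n h := by rw [Pi.algebraMap_apply, AlgHom.commutes, Pi.algebraMap_apply]

theorem powIdeal_le_comap {A B : Type*} [Ring A] [Algebra O A] [Ring B] [Algebra O B]
    (f : A →ₐ[O] B) (n : ℕ) :
    powIdeal π A n ≤ (powIdeal π B n).comap f := by
  intro a ha
  rw [mem_powIdeal] at ha
  obtain ⟨c, rfl⟩ := ha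
  rw [Ideal.mem_comap, mem_powIdeal]
  exact ⟨f c, map_smul f _ _⟩

/-- The homomorphism of completions induced by a homomorphism of `O`-algebras. -/
def completionMap {A B : Type*} [Ring A] [Algebra O A] [Ring B] [Algebra O B]
    (f : A →ₐ[O] B) : completion π A →ₐ[O] completion π B :=
  AlgHom.codRestrict
    (AlgHom.comp
      (AlgHom.pi fun n =>
        (Ideal.quotientMapₐ (powIdeal π B n) f (powIdeal_le_comap π f n)).comp
          (Pi.evalAlgHom O (fun n => A ⧸ powIdeal π A n) n))
      (completion π A).val)
    (completion π B) (by
      rintro ⟨x, hx⟩ m n h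
      have h1 := hx h
      change Ideal.Quotient.factorₐ O (powIdeal_anti π B h)
          (Ideal.quotientMapₐ (powIdeal π B n) f (powIdeal_le_comap π f n) (x n)) =
        Ideal.quotientMapₐ (powIdeal π B m) f (powIdeal_le_comap π f m) (x m)
      rw [← h1]
      obtain ⟨a, ha⟩ := Ideal.Quotient.mk_surjective (x n)
      rw [← ha]
      rfl)

theorem powIdeal_le_ker {A : Type*} [Ring A] [Algebra O A] (f : A →ₐ[O] O) (n : ℕ) (a : A)
    (ha : a ∈ powIdeal π A n) :
    ((Ideal.Quotient.mk (Ideal.span {π} ^ n)).comp (f : A →+* O)) a = 0 := by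
  rw [mem_powIdeal] at ha
  obtain ⟨c, rfl⟩ := ha
  rw [RingHom.comp_apply, Ideal.Quotient.eq_zero_iff_mem, Ideal.span_singleton_pow,
    Ideal.mem_span_singleton]
  exact ⟨f c, by simp⟩

/-- The map `lim A / π ^ n A → O / π ^ n O` induced by an algebra homomorphism `f : A → O`. -/
def completionToQuot {A : Type*} [Ring A] [Algebra O A] (f : A →ₐ[O] O) (n : ℕ) :
    completion π A →+* O ⧸ Ideal.span {π} ^ n :=
  (Ideal.Quotient.lift (powIdeal π A n)
      ((Ideal.Quotient.mk (Ideal.span {π} ^ n)).comp (f : A →+* O)) (powIdeal_le_ker π f n)).comp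
    ((Pi.evalRingHom (fun n => A ⧸ powIdeal π A n) n).comp
      ((completion π A).val : completion π A →+* ∀ n : ℕ, A ⧸ powIdeal π A n))

theorem completionToQuot_compat {A : Type*} [Ring A] [Algebra O A] (f : A →ₐ[O] O) {m n : ℕ}
    (h : m ≤ n) :
    (Ideal.Quotient.factorPow (Ideal.span {π}) h).comp (completionToQuot π f n) =
      completionToQuot π f m := by
  ext ⟨x, hx⟩
  have h1 := hx h
  change Ideal.Quotient.factorPow (Ideal.span {π}) h (Ideal.Quotient.lift (powIdeal π A n)
      ((Ideal.Quotient.mk (Ideal.span {π} ^ n)).comp (f : A →+* O)) (powIdeal_le_ker π f n) (x n)) =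
    Ideal.Quotient.lift (powIdeal π A m)
      ((Ideal.Quotient.mk (Ideal.span {π} ^ m)).comp (f : A →+* O)) (powIdeal_le_ker π f m) (x m)
  rw [← h1]
  obtain ⟨a, ha⟩ := Ideal.Quotient.mk_surjective (x n)
  rw [← ha]
  rfl

/-- If `O` is `π`-adically complete, an algebra homomorphism `f : A → O` extends by continuity to
the completion of `A`: the value at `x` is the element of `O` that is congruent modulo `π ^ n` to
the image of the `n`-th component of `x`, for all `n`. -/
def completionLift [IsAdicComplete (Ideal.span {π}) O] {A : Type*} [Ring A] [Algebra O A]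
    (f : A →ₐ[O] O) : completion π A →ₐ[O] O where
  __ := IsAdicComplete.liftRingHom (Ideal.span {π}) (completionToQuot π f)
    (completionToQuot_compat π f)
  commutes' r := by
    change IsAdicComplete.liftRingHom (Ideal.span {π}) (completionToQuot π f)
      (completionToQuot_compat π f) (algebraMap O (completion π A) r) = r
    refine IsHausdorff.eq_iff_smodEq (I := Ideal.span {π}) |>.2 fun n => ?_
    rw [smul_eq_mul, Ideal.mul_top, SModEq]
    refine (IsAdicComplete.mk_liftRingHom (Ideal.span {π}) (completionToQuot π f)
      (completionToQuot_compat π f) n (algebraMap O (completion π A) r)).trans ?_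
    change Ideal.Quotient.mk (Ideal.span {π} ^ n) (f (algebraMap O A r)) = _
    rw [AlgHom.commutes]
    rfl

end Completion

/-! ### Extension of scalars along a homomorphism of non-commutative rings -/

section Induced

variable {S R : Type*} [Ring S] [Ring R] (φ : S →+* R)
variable (M : Type*) [AddCommGroup M] [Module S M]

/-- The relations `r φ(s) ⊗ m = r ⊗ s m` in `R ⊗_ℤ M`. -/
def balancedRelations : Submodule R (R ⊗[ℤ] M) :=
  Submodule.span R {x | ∃ (r : R) (s : S) (m : M), x = (r * φ s) ⊗ₜ[ℤ] m - r ⊗ₜ[ℤ] (s • m)}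

/-- The left `R`-module `R ⊗_S M`, for a ring homomorphism `φ : S → R` and a left
`S`-module `M`. -/
abbrev InducedModule : Type _ := (R ⊗[ℤ] M) ⧸ balancedRelations φ M

end Induced

/-- The one-dimensional module `K v` on which `S` acts through `χ : S → K`. -/
def CharModule {S K : Type*} [Ring S] [Field K] (_χ : S →+* K) : Type _ := K

instance {S K : Type*} [Ring S] [Field K] (χ : S →+* K) : AddCommGroup (CharModule χ) :=
  inferInstanceAs (AddCommGroup K)

instance {S K : Type*} [Ring S] [Field K] (χ : S →+* K) : Module S (CharModule χ) :=
  Module.compHom K χ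

/-! ### Affinoid enveloping algebras -/

section Envelope

variable {O : Type*} [CommRing O] (π : O)

/-- The `π`-adic completion of the enveloping algebra `U(L)` of an `O`-Lie algebra `L`. -/
abbrev IntegralEnvelope (L : Type*) [LieRing L] [LieAlgebra O L] : Type _ :=
  completion π (UniversalEnvelopingAlgebra O L)

/-- The affinoid enveloping algebra with coefficients in `K`. -/
abbrev AffinoidEnvelope (K : Type*) [Field K] [Algebra O K]
    (L : Type*) [LieRing L] [LieAlgebra O L] : Type _ :=
  K ⊗[O] IntegralEnvelope π L

/-- Functoriality of the enveloping algebra. -/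
def envelopingMap {L L' : Type*} [LieRing L] [LieAlgebra O L] [LieRing L'] [LieAlgebra O L']
    (f : L →ₗ⁅O⁆ L') : UniversalEnvelopingAlgebra O L →ₐ[O] UniversalEnvelopingAlgebra O L' :=
  UniversalEnvelopingAlgebra.lift O ((UniversalEnvelopingAlgebra.ι O).comp f)

/-- Functoriality of the affinoid enveloping algebra. -/
def affinoidMap (K : Type*) [Field K] [Algebra O K]
    {L L' : Type*} [LieRing L] [LieAlgebra O L] [LieRing L'] [LieAlgebra O L']
    (f : L →ₗ⁅O⁆ L') : AffinoidEnvelope π K L →ₐ[K] AffinoidEnvelope π K L' :=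
  Algebra.TensorProduct.map (AlgHom.id K K) (completionMap π (envelopingMap f))

/-- The `K`-linear extension to the affinoid enveloping algebra of a character `L → O`. -/
def affinoidCharacter [IsAdicComplete (Ideal.span {π}) O] (K : Type*) [Field K] [Algebra O K]
    {L : Type*} [LieRing L] [LieAlgebra O L] (f : L →ₗ⁅O⁆ O) : AffinoidEnvelope π K L →ₐ[K] K :=
  Algebra.TensorProduct.lift (AlgHom.id K K)
    ((Algebra.ofId O K).comp (completionLift π (UniversalEnvelopingAlgebra.lift O f)))
    fun _ _ => Commute.all _ _

end Envelope

/-! ### The valuation ring of a finite extension of `ℚ_p` -/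

section Padic

variable (p : ℕ) [Fact p.Prime] (K : Type*) [Field K] [Algebra ℚ_[p] K]
  [FiniteDimensional ℚ_[p] K]

/-- The valuation ring of `K`: the closed unit ball for the unique extension to `K` of the `p`-adic
absolute value. -/
def valRing : Subring K where
  carrier := {x | spectralNorm ℚ_[p] K x ≤ 1}
  mul_mem' {x y} hx hy := by
    let := spectralNorm.normedField ℚ_[p] K
    change ‖x * y‖ ≤ 1
    rw [norm_mul]
    exact mul_le_one₀ hx (norm_nonneg y) hy
  one_mem' := by
    let := spectralNorm.normedField ℚ_[p] K
    change ‖(1 : K)‖ ≤ 1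
    exact norm_one.le
  add_mem' {x y} hx hy :=
    (isNonarchimedean_spectralNorm (K := ℚ_[p]) (L := K) x y).trans (max_le hx hy)
  zero_mem' := by
    let := spectralNorm.normedField ℚ_[p] K
    change ‖(0 : K)‖ ≤ 1
    simp
  neg_mem' {x} hx := by
    let := spectralNorm.normedField ℚ_[p] K
    change ‖-x‖ ≤ 1
    rw [norm_neg]
    exact hx

variable {p K}

theorem isAdicComplete_valRing {π : valRing p K} (hπ : Irreducible π) :
    IsAdicComplete (Ideal.span {π}) (valRing p K) := by
  let := spectralNorm.normedField ℚ_[p] K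
  have : CompleteSpace K := spectralNorm.completeSpace ℚ_[p] K
  have hπ0 : (π : K) ≠ 0 := fun h => hπ.ne_zero (Subtype.ext h)
  have hpos : 0 < ‖(π : K)‖ := norm_pos_iff.2 hπ0
  have hlt : ‖(π : K)‖ < 1 := by
    refine lt_of_le_of_ne π.2 fun h => hπ.not_isUnit ?_
    have hinv : (π : K)⁻¹ ∈ valRing p K := by
      change ‖(π : K)⁻¹‖ ≤ 1
      rw [norm_inv, show ‖(π : K)‖ = 1 from h, inv_one]
    exact IsUnit.of_mul_eq_one ⟨_, hinv⟩ (Subtype.ext (mul_inv_cancel₀ hπ0))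
  have key : ∀ (n : ℕ) (x y : valRing p K),
      x ≡ y [SMOD (Ideal.span {π} ^ n • ⊤ : Ideal (valRing p K))] ↔
        ‖(x : K) - y‖ ≤ ‖(π : K)‖ ^ n := by
    intro n x y
    rw [smul_eq_mul, Ideal.mul_top, SModEq.sub_mem, Ideal.span_singleton_pow,
      Ideal.mem_span_singleton]
    constructor
    · rintro ⟨c, hc⟩
      have h1 : (x : K) - y = (π : K) ^ n * c := by
        simpa using congrArg (Subtype.val : valRing p K → K) hc
      rw [h1, norm_mul, norm_pow]
      exact mul_le_of_le_one_right (by positivity) c.2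
    · intro h
      have hc : ((π : K) ^ n)⁻¹ * ((x : K) - y) ∈ valRing p K := by
        change ‖((π : K) ^ n)⁻¹ * ((x : K) - y)‖ ≤ 1
        rw [norm_mul, norm_inv, norm_pow, inv_mul_le_one₀ (by positivity)]
        exact h
      refine ⟨⟨_, hc⟩, Subtype.ext ?_⟩
      simp [mul_inv_cancel_left₀ (pow_ne_zero n hπ0)]
  have hpow : Filter.Tendsto (fun n : ℕ => ‖(π : K)‖ ^ n) Filter.atTop (nhds 0) :=
    tendsto_pow_atTop_nhds_zero_of_lt_one hpos.le hlt
  refine { haus' := ?_, prec' := ?_ }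
  · intro x hx
    have h0 : ‖(x : K)‖ ≤ 0 := ge_of_tendsto' hpow fun n => by
      simpa using (key n x 0).1 (hx n)
    exact Subtype.ext (norm_le_zero_iff.1 h0)
  · intro f hf
    have hC : CauchySeq fun n => (f n : K) := by
      refine cauchySeq_of_le_tendsto_0' (fun n => ‖(π : K)‖ ^ n) (fun m n h => ?_) hpow
      rw [dist_eq_norm]
      exact (key m _ _).1 (hf h)
    obtain ⟨x, hx⟩ := cauchySeq_tendsto_of_complete hC
    have hx1 : ‖x‖ ≤ 1 := le_of_tendsto' hx.norm fun n => (f n).2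
    refine ⟨⟨x, hx1⟩, fun n => (key n _ _).2 ?_⟩
    refine le_of_tendsto (hx.const_sub (f n : K)).norm ?_
    filter_upwards [Filter.eventually_ge_atTop n] with m hm
    exact (key n _ _).1 (hf hm)

/-- A vector space over `K` is a module over the valuation ring, and a Lie algebra over `K` is a Lie
algebra over the valuation ring, by restriction of scalars. -/
instance {g : Type*} [LieRing g] [LieAlgebra K g] : LieAlgebra (valRing p K) g where
  lie_smul t x y := lie_smul (t : K) x y

/-- An `O`-Lie lattice in a Lie algebra over `K`: an `O`-Lie subalgebra with
`⋂ π ^ n L = 0` that spans over `K`. -/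
structure IsLieLattice (π : valRing p K) {g : Type*} [LieRing g] [LieAlgebra K g]
    (L : LieSubalgebra (valRing p K) g) : Prop where
  separated : ∀ x : g, (∀ n : ℕ, ∃ y ∈ L, x = π ^ n • y) → x = 0
  spans : Submodule.span K (L : Set g) = ⊤

/-- A polarisation of `g` at the linear form `lam`. -/
structure IsPolarisation {k : Type*} [Field k] {g : Type*} [LieRing g] [LieAlgebra k g]
    (lam : Module.Dual k g) (b : LieSubalgebra k g) : Prop where
  solvable : LieAlgebra.IsSolvable b
  mem_iff : ∀ u : g, (∀ v ∈ b, lam ⁅u, v⁆ = 0) ↔ u ∈ b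

section Dixmier

variable {g : Type*} [LieRing g] [LieAlgebra K g]

/-- The `O`-Lie lattice `b ∩ L` in a subalgebra `b`. -/
def latticeInter (b : LieSubalgebra K g) (L : LieSubalgebra (valRing p K) g) :
    LieSubalgebra (valRing p K) g where
  carrier := {x | x ∈ b ∧ x ∈ L}
  add_mem' hx hy := ⟨add_mem hx.1 hy.1, add_mem hx.2 hy.2⟩
  zero_mem' := ⟨zero_mem b, zero_mem L⟩
  smul_mem' c _ hx := ⟨b.smul_mem (c : K) hx.1, L.smul_mem c hx.2⟩
  lie_mem' hx hy := ⟨b.lie_mem hx.1 hy.1, L.lie_mem hx.2 hy.2⟩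

theorem latticeInter_le (b : LieSubalgebra K g) (L : LieSubalgebra (valRing p K) g) :
    latticeInter b L ≤ L := fun _ hx => hx.2

variable (L : LieSubalgebra (valRing p K) g) (lam : Module.Dual K g)
  (hlam : ∀ x ∈ L, lam x ∈ valRing p K) (b : LieSubalgebra K g) (hb : IsPolarisation lam b)

/-- The restriction of `lam` to a character `b ∩ L → O`. -/
def restrictCharacter : latticeInter b L →ₗ⁅valRing p K⁆ valRing p K where
  toFun x := ⟨lam x, hlam x x.2.2⟩
  map_add' x y := Subtype.ext (map_add lam (x : g) (y : g))
  map_smul' c x := Subtype.ext (map_smul lam (c : K) (x : g))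
  map_lie' {x y} := by
    rw [Ring.lie_def, mul_comm, sub_self]
    exact Subtype.ext ((hb.mem_iff x).2 x.2.1 y y.2.1)

variable {π : valRing p K} (hπ : Irreducible π)

/-- The action of the affinoid enveloping algebra of `b ∩ L` on the one-dimensional module
`K_lam`. -/
def dixmierCharacter : AffinoidEnvelope π K (latticeInter b L) →ₐ[K] K :=
  haveI := isAdicComplete_valRing hπ
  affinoidCharacter π K (restrictCharacter L lam hlam b hb)

/-- The affinoid Dixmier module of `L` at `lam` with respect to the polarisation `b`. -/
abbrev AffinoidDixmierModule : Type _ :=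
  InducedModule
    (affinoidMap π K (LieSubalgebra.inclusion (latticeInter_le b L)) :
      AffinoidEnvelope π K (latticeInter b L) →+* AffinoidEnvelope π K L)
    (CharModule (dixmierCharacter L lam hlam b hb hπ :
      AffinoidEnvelope π K (latticeInter b L) →+* K))

end Dixmier

end Padic

end AffinoidDixmier

end

noncomputable section

namespace AffinoidDixmier

/-! ### Arithmetic of `π`-adic completions -/

section CompletionArithmetic

variable {O : Type*} [CommRing O] {π : O} {A : Type*} [Ring A] [Algebra O A]

/-! The polarisation and the module are built together, by induction on the dimension of a
subalgebra h of g with lattice M = h ∩ L. If λ vanishes on [h, h], take b = h and let M act on O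
through λ. Otherwise let A be the largest ideal of h inside ker λ, and choose y in the second centre
of h modulo A but not in the first (`exists_second_center`). Then h' = {u ∈ h : λ([u, y]) = 0} is an
ideal of codimension one, and a polarisation of h' is also one of h.

Choose x ∈ M with λ([x, y]) of least valuation; then M = Ox ⊕ (h' ∩ L) (`exists_isSplitExtension`).
If V is a complete model for h', the induced module is V⟨X⟩, realised as null sequences: x is
multiplication by X, and an element u of the ideal acts by ∑ (-1)^k ρ((ad x)^k u) ∂^k/k!, which is
what moving u past powers of x produces. The operators ∂^k/k! have binomial coefficients, so
everything stays integral.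

On V⟨X⟩ the element y acts as b - c d/dX with scalars b and c ≠ 0, so x(y - b) multiplies the X^m
term by -cm. Hence the product of the cj + x(y - b) for 1 ≤ j ≤ n is c^n n! times a diagonal
operator with entries ∏ (j - m)/j. These entries are integers, equal to 1 at m = 0 and to 0 for 1 ≤
m ≤ n. Dividing by c^n n! costs only a power of π and isolates the constant term modulo a prescribed
power of π, without enlarging the tail. Together with the irreducibility of V this gives the
inductive step (`IsDixmierModel.induced`).

The density and kernel conditions on a model are stated for U(M) modulo π, and successive
approximation lifts them to the completion. The orbit map of the generator v is then onto V, and its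
kernel lies in the left ideal generated by finitely many elements m - λ(m). As 1 + πw is invertible
in the completion, every element outside the kernel has a left multiple that is a power of π modulo
this ideal, whence simplicity after inverting π (`isSimpleModule_of_model`). -/

theorem completion_ext {x y : completion π A} (h : ∀ n, x.1 n = y.1 n) : x = y :=
  Subtype.ext (funext h)

theorem completion_factor (x : completion π A) {m n : ℕ} (h : m ≤ n) {a : A}
    (ha : x.1 n = Ideal.Quotient.mk _ a) : x.1 m = Ideal.Quotient.mk _ a := by
  rw [← x.2 h, ha]
  rfl

theorem mk_pow_smul {m n : ℕ} (h : m ≤ n) (a : A) :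
    (Ideal.Quotient.mk (powIdeal π A m) (π ^ n • a)) = 0 := by
  rw [Ideal.Quotient.eq_zero_iff_mem]
  exact powIdeal_anti π A h ((mem_powIdeal π).2 ⟨a, rfl⟩)

theorem pow_smul_quotient {m n : ℕ} (h : m ≤ n) (x : A ⧸ powIdeal π A m) : π ^ n • x = 0 := by
  obtain ⟨a, rfl⟩ := Ideal.Quotient.mk_surjective x
  exact mk_pow_smul h a

/-- An element all of whose truncations are divisible by high powers of `π` vanishes. -/
theorem completion_separated {x : completion π A} (h : ∀ n, ∃ y : completion π A, x = π ^ n • y) :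
    x = 0 := by
  refine completion_ext fun n => ?_
  obtain ⟨y, rfl⟩ := h n
  exact pow_smul_quotient le_rfl _

/-- The sum `∑ π ^ n c n` in the completion. -/
def completionSeries (c : ℕ → completion π A) : completion π A :=
  ⟨fun n => ∑ i ∈ Finset.range n, π ^ i • (c i).1 n, by
    intro m n h
    rw [map_sum, ← Finset.sum_subset (Finset.range_mono h)]
    · refine Finset.sum_congr rfl fun i _ => ?_
      rw [map_smul, (c i).2 h]
    · intro i _ hi
      rw [map_smul]
      exact pow_smul_quotient (by simpa using hi) _⟩

/-- Component n of the series stops before index n, and the omitted term is divisible by π^n; so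
removing the first summand leaves a series of the same kind. The geometric series and the lifting
arguments below rest on this recursion. -/
theorem completionSeries_eq (c : ℕ → completion π A) :
    completionSeries c = c 0 + π • completionSeries fun n => c (n + 1) := by
  refine completion_ext fun n => ?_
  change ∑ i ∈ Finset.range n, π ^ i • (c i).1 n =
    (c 0).1 n + π • ∑ i ∈ Finset.range n, π ^ i • (c (i + 1)).1 n
  rw [Finset.smul_sum]
  have h := (Finset.sum_range_succ (fun i => π ^ i • (c i).1 n) n).symm.trans
    (Finset.sum_range_succ' (fun i => π ^ i • (c i).1 n) n)
  rw [pow_smul_quotient le_rfl, add_zero] at h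
  rw [h, pow_zero, one_smul, add_comm]
  congr 1
  exact Finset.sum_congr rfl fun i _ => by rw [smul_smul, pow_succ']

theorem completionSeries_mul (c : ℕ → completion π A) (k : completion π A) :
    completionSeries (fun n => c n * k) = completionSeries c * k := by
  refine completion_ext fun n => ?_
  change ∑ i ∈ Finset.range n, π ^ i • ((c i).1 n * k.1 n) =
    (∑ i ∈ Finset.range n, π ^ i • (c i).1 n) * k.1 n
  rw [Finset.sum_mul]
  exact Finset.sum_congr rfl fun i _ => by rw [smul_mul_assoc]

/-- The canonical map from an algebra to its completion. -/
def toCompletion (π : O) (A : Type*) [Ring A] [Algebra O A] : A →ₐ[O] completion π A where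
  toFun a := ⟨fun _ => Ideal.Quotient.mk _ a, fun _ _ _ => rfl⟩
  map_one' := rfl
  map_mul' _ _ := rfl
  map_zero' := rfl
  map_add' _ _ := rfl
  commutes' _ := rfl

/-- An element with vanishing truncation modulo `π` is divisible by `π`; so every element of the
completion is congruent modulo `π` to an element of `A`. -/
theorem completion_exists_eq (x : completion π A) :
    ∃ (a : A) (y : completion π A), x = toCompletion π A a + π • y := by
  choose a ha using fun n => Ideal.Quotient.mk_surjective (x.1 n)
  have hc : ∀ n, ∃ c, a (n + 1) - a n = π ^ n • c := fun n => by
    rw [← mem_powIdeal, ← Ideal.Quotient.mk_eq_mk_iff_sub_mem, ha n]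
    exact (completion_factor x n.le_succ (ha (n + 1)).symm).symm
  choose c hc using hc
  refine ⟨a 1, completionSeries fun n => toCompletion π A (c (n + 1)),
    completion_ext fun n => ?_⟩
  have key : ∀ n, a (n + 1) = a 1 + π • ∑ i ∈ Finset.range n, π ^ i • c (i + 1) := by
    intro n
    induction n with
    | zero => simp
    | succ n ih =>
      rw [Finset.sum_range_succ, smul_add, ← add_assoc, ← ih, smul_smul, ← pow_succ', ← hc]
      abel
  rw [completion_factor x n.le_succ (ha (n + 1)).symm, key n, map_add]
  change _ = _ + π • ∑ i ∈ Finset.range n, π ^ i • (Ideal.Quotient.mk (powIdeal π A n) (c (i + 1)))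
  congr 1
  change Ideal.Quotient.mkₐ O (powIdeal π A n) _ =
    π • ∑ i ∈ Finset.range n, π ^ i • (Ideal.Quotient.mkₐ O (powIdeal π A n) _)
  simp only [map_smul, map_sum]

/-- The geometric series inverts `1 + π w`. -/
theorem completion_exists_inverse (w : completion π A) :
    ∃ s : completion π A, s * (1 + π • w) = 1 := by
  refine ⟨completionSeries fun n => (-w) ^ n, ?_⟩
  have h := completionSeries_eq fun n => (-w) ^ n
  have h2 : (completionSeries fun n => (-w) ^ (n + 1)) =
      (completionSeries fun n => (-w) ^ n) * (-w) := by
    rw [← completionSeries_mul]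
    simp only [pow_succ]
  rw [h2, pow_zero] at h
  rw [mul_add, mul_one, mul_smul_comm]
  nth_rewrite 1 [h]
  have h3 : ∀ s : completion π A, s * -w = -(s * w) := fun s => mul_neg s w
  rw [h3, smul_neg]
  abel

end CompletionArithmetic

/-! ### Complete modules and the orbit map of a vector -/

/-- A torsion-free, separated and complete module for the `π`-adic topology. -/
structure PiComplete {O : Type*} [CommRing O] (π : O) (V : Type*) [AddCommGroup V] [Module O V] :
    Prop where
  torsionFree : ∀ v : V, π • v = 0 → v = 0
  separated : ∀ v : V, (∀ n : ℕ, ∃ w : V, v = π ^ n • w) → v = 0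
  series : ∀ a : ℕ → V, ∃ l : V, ∀ n : ℕ, ∃ w : V, l - ∑ i ∈ Finset.range n, π ^ i • a i = π ^ n • w

section OrbitMap

variable {O : Type*} [CommRing O] {π : O} {A : Type*} [Ring A] [Algebra O A]
  {V : Type*} [AddCommGroup V] [Module O V]

theorem PiComplete.pow_torsionFree (hV : PiComplete π V) (n : ℕ) {v : V} (h : π ^ n • v = 0) :
    v = 0 := by
  induction n with
  | zero => simpa using h
  | succ n ih =>
    rw [pow_succ', mul_smul] at h
    exact ih (hV.torsionFree _ h)

/-- Lifts a_n of the components differ successively by multiples of π^n, so the vectors φ(a_n)v are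
partial sums of a π-adic series. Quantifying over all representatives makes the limit independent of
the chosen lifts. -/
theorem exists_orbit_limit (hV : PiComplete π V) (φ : A →ₐ[O] Module.End O V) (v : V)
    (x : completion π A) : ∃ l : V, ∀ n (a : A), x.1 n = Ideal.Quotient.mk _ a →
      ∃ w : V, l - φ a v = π ^ n • w := by
  choose a ha using fun n => Ideal.Quotient.mk_surjective (x.1 n)
  have hc : ∀ n, ∃ c, a (n + 1) - a n = π ^ n • c := fun n => by
    rw [← mem_powIdeal, ← Ideal.Quotient.mk_eq_mk_iff_sub_mem, ha n]
    exact (completion_factor x n.le_succ (ha (n + 1)).symm).symm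
  choose c hc using hc
  obtain ⟨l, hl⟩ := hV.series fun n => φ (c n) v
  refine ⟨l + φ (a 0) v, fun n b hb => ?_⟩
  obtain ⟨w, hw⟩ := hl n
  have key : a n = a 0 + ∑ i ∈ Finset.range n, π ^ i • c i := by
    rw [← Finset.sum_congr rfl fun i _ => hc i, Finset.sum_range_sub]
    abel
  obtain ⟨d, hd⟩ : ∃ d, a n - b = π ^ n • d := by
    rw [← mem_powIdeal, ← Ideal.Quotient.mk_eq_mk_iff_sub_mem, ha n, hb]
  refine ⟨w + φ d v, ?_⟩
  have h1 : φ (a n) v = φ (a 0) v + ∑ i ∈ Finset.range n, π ^ i • φ (c i) v := by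
    rw [key]
    simp [map_sum, LinearMap.sum_apply]
  have h2 : φ (a n) v - φ b v = π ^ n • φ d v := by
    rw [← LinearMap.sub_apply, ← map_sub, hd, map_smul, LinearMap.smul_apply]
  rw [smul_add, ← hw, ← h2, h1]
  abel

/-- The orbit map `u ↦ u v`, extended by continuity to the completion. -/
def orbitFun (hV : PiComplete π V) (φ : A →ₐ[O] Module.End O V) (v : V) (x : completion π A) : V :=
  (exists_orbit_limit hV φ v x).choose

theorem orbitFun_spec (hV : PiComplete π V) (φ : A →ₐ[O] Module.End O V) (v : V)
    (x : completion π A) (n : ℕ) (a : A) (h : x.1 n = Ideal.Quotient.mk _ a) :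
    ∃ w : V, orbitFun hV φ v x - φ a v = π ^ n • w :=
  (exists_orbit_limit hV φ v x).choose_spec n a h

/-- Since V is separated, one representative at each level already determines the limit; linearity
and multiplicativity of the orbit map are all checked through this criterion. -/
theorem eq_orbitFun (hV : PiComplete π V) (φ : A →ₐ[O] Module.End O V) (v : V)
    (x : completion π A) {l : V} (h : ∀ n, ∃ a : A, x.1 n = Ideal.Quotient.mk _ a ∧
      ∃ w : V, l - φ a v = π ^ n • w) : orbitFun hV φ v x = l := by
  rw [← sub_eq_zero]
  refine hV.separated _ fun n => ?_
  obtain ⟨a, ha, w, hw⟩ := h n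
  obtain ⟨w', hw'⟩ := orbitFun_spec hV φ v x n a ha
  exact ⟨w' - w, by rw [smul_sub, ← hw, ← hw']; abel⟩

/-- The orbit map as a linear map. -/
def orbitMap (hV : PiComplete π V) (φ : A →ₐ[O] Module.End O V) (v : V) :
    completion π A →ₗ[O] V where
  toFun := orbitFun hV φ v
  map_add' x y := by
    refine eq_orbitFun hV φ v _ fun n => ?_
    obtain ⟨a, ha⟩ := Ideal.Quotient.mk_surjective (x.1 n)
    obtain ⟨b, hb⟩ := Ideal.Quotient.mk_surjective (y.1 n)
    refine ⟨a + b, by rw [map_add, ha, hb]; rfl, ?_⟩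
    obtain ⟨w, hw⟩ := orbitFun_spec hV φ v x n a ha.symm
    obtain ⟨z, hz⟩ := orbitFun_spec hV φ v y n b hb.symm
    exact ⟨w + z, by rw [smul_add, ← hw, ← hz, map_add, LinearMap.add_apply]; abel⟩
  map_smul' r x := by
    refine eq_orbitFun hV φ v _ fun n => ?_
    obtain ⟨a, ha⟩ := Ideal.Quotient.mk_surjective (x.1 n)
    refine ⟨r • a, ?_, ?_⟩
    · change r • x.1 n = _
      rw [← ha]
      rfl
    · obtain ⟨w, hw⟩ := orbitFun_spec hV φ v x n a ha.symm
      exact ⟨r • w, by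
        rw [smul_comm, ← hw, map_smul, LinearMap.smul_apply, smul_sub, RingHom.id_apply]⟩

variable (hV : PiComplete π V) (φ : A →ₐ[O] Module.End O V) (v : V)

theorem orbitMap_toCompletion (a : A) : orbitMap hV φ v (toCompletion π A a) = φ a v :=
  eq_orbitFun hV φ v _ fun _ => ⟨a, rfl, 0, by simp⟩

theorem orbitMap_toCompletion_mul (a : A) (x : completion π A) :
    orbitMap hV φ v (toCompletion π A a * x) = φ a (orbitMap hV φ v x) := by
  refine eq_orbitFun hV φ v _ fun n => ?_
  obtain ⟨b, hb⟩ := Ideal.Quotient.mk_surjective (x.1 n)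
  refine ⟨a * b, ?_, ?_⟩
  · rw [map_mul, hb]
    rfl
  · obtain ⟨w, hw⟩ := orbitFun_spec hV φ v x n b hb.symm
    exact ⟨φ a w, by
      rw [map_mul, Module.End.mul_apply, ← map_sub, ← map_smul, ← hw]
      rfl⟩

/-- A subalgebra acting on the vector `v` through a character acts on the right of the orbit map
through the continuous extension of this character. -/
theorem orbitMap_mul_completionMap [IsAdicComplete (Ideal.span {π}) O] {B : Type*} [Ring B]
    [Algebra O B] (f : B →ₐ[O] A) (χ : B →ₐ[O] O) (hχ : ∀ b, φ (f b) v = χ b • v)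
    (x : completion π A) (y : completion π B) :
    orbitMap hV φ v (x * completionMap π f y) = completionLift π χ y • orbitMap hV φ v x := by
  refine eq_orbitFun hV φ v _ fun n => ?_
  obtain ⟨a, ha⟩ := Ideal.Quotient.mk_surjective (x.1 n)
  obtain ⟨b, hb⟩ := Ideal.Quotient.mk_surjective (y.1 n)
  obtain ⟨w, hw⟩ := orbitFun_spec hV φ v x n a ha.symm
  have hc : ∃ r : O, completionLift π χ y - χ b = π ^ n * r := by
    rw [← dvd_def, ← Ideal.mem_span_singleton, ← Ideal.span_singleton_pow,
      ← Ideal.Quotient.mk_eq_mk_iff_sub_mem]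
    refine (IsAdicComplete.mk_liftRingHom (Ideal.span {π}) (completionToQuot π χ)
      (completionToQuot_compat π χ) n y).trans ?_
    change Ideal.Quotient.lift (powIdeal π B n)
      ((Ideal.Quotient.mk (Ideal.span {π} ^ n)).comp (χ : B →+* O)) (powIdeal_le_ker π χ n) (y.1 n)
        = _
    rw [← hb]
    rfl
  obtain ⟨r, hr⟩ := hc
  refine ⟨a * f b, ?_, completionLift π χ y • w + r • φ a v, ?_⟩
  · rw [map_mul, ha]
    change x.1 n * Ideal.quotientMapₐ (powIdeal π A n) f (powIdeal_le_comap π f n) (y.1 n) = _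
    rw [← hb]
    rfl
  · rw [map_mul, Module.End.mul_apply, hχ, map_smul, smul_add, smul_comm, ← hw, smul_smul, ← hr]
    change _ • orbitFun hV φ v x - _ = _
    rw [sub_smul, smul_sub]
    abel

/-- If the kernel of `a ↦ a v` modulo `π` is generated by `k`, then the kernel of the completed
orbit map is generated by `k`. -/
theorem orbitMap_ker {s : ℕ} (k : Fin s → A) (hk : ∀ i, φ (k i) v = 0)
    (hker : ∀ a : A, (∃ w, φ a v = π • w) → ∃ (c : Fin s → A) (b : A),
      a = ∑ i, c i * k i + π • b) (x : completion π A) (hx : orbitMap hV φ v x = 0) :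
    ∃ c : Fin s → completion π A, x = ∑ i, c i * toCompletion π A (k i) := by
  have hk' : ∀ (i) (c : completion π A), orbitMap hV φ v (c * toCompletion π A (k i)) = 0 := by
    intro i c
    refine eq_orbitFun hV φ v _ fun n => ?_
    obtain ⟨a, ha⟩ := Ideal.Quotient.mk_surjective (c.1 n)
    refine ⟨a * k i, by rw [map_mul, ha]; rfl, 0, ?_⟩
    rw [map_mul, Module.End.mul_apply, hk]
    simp
  -- Torsion-freeness lets the correction be divided by π without leaving the kernel, so the
  -- approximation can be repeated indefinitely.
  have step : ∀ y : {y : completion π A // orbitMap hV φ v y = 0},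
      ∃ (c : Fin s → completion π A) (z : {y : completion π A // orbitMap hV φ v y = 0}),
        y.1 = ∑ i, c i * toCompletion π A (k i) + π • z.1 := by
    rintro ⟨y, hy⟩
    obtain ⟨a, y', h⟩ := completion_exists_eq y
    have ha : ∃ w, φ a v = π • w := by
      rw [h, map_add, orbitMap_toCompletion, map_smul] at hy
      exact ⟨-orbitMap hV φ v y', by rw [smul_neg]; exact eq_neg_of_add_eq_zero_left hy⟩
    obtain ⟨c, b, rfl⟩ := hker a ha
    have h1 : y = ∑ i, toCompletion π A (c i) * toCompletion π A (k i) +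
        π • (toCompletion π A b + y') := by
      rw [h]
      simp only [map_add, map_sum, map_mul, map_smul, smul_add, add_assoc]
    refine ⟨fun i => toCompletion π A (c i), ⟨toCompletion π A b + y', hV.torsionFree _ ?_⟩, h1⟩
    rw [h1, map_add, map_sum, Finset.sum_eq_zero fun i _ => hk' i _, zero_add, map_smul] at hy
    exact hy
  choose c z hz using step
  let y : ℕ → {y : completion π A // orbitMap hV φ v y = 0} :=
    fun n => Nat.rec ⟨x, hx⟩ (fun _ y => z y) n
  have hy : ∀ n, (y n).1 = ∑ i, c (y n) i * toCompletion π A (k i) + π • (y (n + 1)).1 :=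
    fun n => hz (y n)
  refine ⟨fun i => completionSeries fun n => c (y n) i, ?_⟩
  rw [← sub_eq_zero]
  refine completion_separated fun n => ?_
  -- The starting index m is left free because each use of the recursion for the series advances it
  -- by one.
  have key : ∀ n m, ∃ d, (y m).1 - ∑ i, (completionSeries fun j => c (y (m + j)) i) *
      toCompletion π A (k i) = π ^ n • d := by
    intro n
    induction n with
    | zero => exact fun m => ⟨_, by rw [pow_zero, one_smul]⟩
    | succ n ih =>
      intro m
      obtain ⟨d, hd⟩ := ih (m + 1)
      refine ⟨d, ?_⟩
      rw [pow_succ', mul_smul, ← hd, hy m]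
      have h2 : ∀ i, (completionSeries fun j => c (y (m + j)) i) = c (y m) i +
          π • completionSeries fun j => c (y (m + 1 + j)) i := fun i => by
        rw [completionSeries_eq]
        simp only [add_zero, add_assoc, add_comm 1]
      simp only [h2, add_mul, Finset.sum_add_distrib, smul_mul_assoc, ← Finset.smul_sum, smul_sub]
      abel
  have h3 := key n 0
  simp only [zero_add] at h3
  exact h3

end OrbitMap

/-! ### Inducing a representation along an ideal of corank one -/

section Sequences

variable {O : Type*} [CommRing O] {V : Type*} [AddCommGroup V] [Module O V]

theorem lie_smul_add_smul_add {E : Type*} [Ring E] [Algebra O E] (r s : O) (S a b : E) :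
    ⁅r • S + a, s • S + b⁆ = r • ⁅S, b⁆ - s • ⁅S, a⁆ + ⁅a, b⁆ := by
  simp only [Ring.lie_def, add_mul, mul_add, smul_mul_assoc, mul_smul_comm, smul_sub]
  simp only [smul_add, smul_comm r s]
  abel_nf

theorem sum_lie_sum_product {E ι : Type*} [Ring E] (s t : Finset ι) (f g : ι → E) :
    ⁅∑ j ∈ s, f j, ∑ k ∈ t, g k⁆ = ∑ j ∈ s, ∑ k ∈ t, ⁅f j, g k⁆ := by
  simp only [Ring.lie_def, Finset.sum_mul_sum, Finset.sum_sub_distrib]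
  rw [Finset.sum_comm (s := t)]

/-- The shift `X` on sequences, i.e. multiplication by the variable on power series. -/
def shiftOp : Module.End O (ℕ → V) where
  toFun f m := match m with
    | 0 => 0
    | m + 1 => f m
  map_add' f g := by
    funext m
    rcases m with _ | m
    · exact (add_zero (0 : V)).symm
    · rfl
  map_smul' r f := by
    funext m
    rcases m with _ | m
    · exact (smul_zero r).symm
    · rfl

@[simp] theorem shiftOp_zero (f : ℕ → V) : shiftOp (O := O) f 0 = 0 := rfl

@[simp] theorem shiftOp_succ (f : ℕ → V) (m : ℕ) : shiftOp (O := O) f (m + 1) = f m := rfl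

/-- The operator `T ∂ ^ k / k!` on power series with coefficients in `V`. -/
def hasseOp (k : ℕ) : Module.End O V →ₗ[O] Module.End O (ℕ → V) where
  toFun T :=
    { toFun := fun f m => (m + k).choose k • T (f (m + k))
      map_add' := fun f g => by funext m; simp
      map_smul' := fun r f => by
        funext m
        simp only [Pi.smul_apply, map_smul, RingHom.id_apply, smul_comm _ r] }
  map_add' S T := by ext; simp
  map_smul' r T := by
    ext f m
    simp only [LinearMap.coe_mk, AddHom.coe_mk, LinearMap.smul_apply, Pi.smul_apply,
      RingHom.id_apply, smul_comm _ r]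

@[simp] theorem hasseOp_apply (k : ℕ) (T : Module.End O V) (f : ℕ → V) (m : ℕ) :
    hasseOp k T f m = (m + k).choose k • T (f (m + k)) := rfl

/-- Divided powers of ∂ compose with a binomial coefficient, while S and T act on the coefficients
only. No factorial is ever inverted. -/
theorem hasseOp_mul (j k : ℕ) (S T : Module.End O V) :
    hasseOp j S * hasseOp k T = (j + k).choose j • hasseOp (j + k) (S * T) := by
  ext f m
  simp only [Module.End.mul_apply, hasseOp_apply, LinearMap.smul_apply, Pi.smul_apply, map_nsmul,
    smul_smul, add_assoc]
  congr 1
  have h := Nat.choose_mul (n := m + (j + k)) (k := j + k) (s := k) (by omega)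
  rw [show m + (j + k) - k = m + j by omega, show j + k - k = j by omega] at h
  rw [Nat.choose_symm_add (a := j), mul_comm ((j + k).choose k), h, mul_comm]

theorem lie_hasseOp (j k : ℕ) (S T : Module.End O V) :
    ⁅hasseOp j S, hasseOp k T⁆ = (j + k).choose j • hasseOp (j + k) ⁅S, T⁆ := by
  rw [Ring.lie_def, Ring.lie_def, hasseOp_mul, hasseOp_mul, map_sub, smul_sub, add_comm k j,
    Nat.choose_symm_add (a := j)]

theorem lie_shiftOp_hasseOp_zero (T : Module.End O V) : ⁅(shiftOp : Module.End O (ℕ → V)), hasseOp 0 T⁆ = 0 := by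
  rw [Ring.lie_def, sub_eq_zero]
  ext f (_ | m)
  · simp
  · simp

/-- Pascal's rule, in the guise [X, ∂^(k+1)/(k+1)!] = -∂^k/k!. -/
theorem lie_shiftOp_hasseOp_succ (k : ℕ) (T : Module.End O V) :
    ⁅(shiftOp : Module.End O (ℕ → V)), hasseOp (k + 1) T⁆ = -hasseOp k T := by
  rw [Ring.lie_def, eq_neg_iff_add_eq_zero, sub_add_eq_add_sub, sub_eq_zero]
  ext f (_ | m)
  · simp [show 0 + (k + 1) = k + 1 by omega]
  · simp only [LinearMap.add_apply, Module.End.mul_apply, Pi.add_apply, shiftOp_succ, hasseOp_apply]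
    rw [show m + 1 + (k + 1) = m + (k + 1) + 1 by omega, shiftOp_succ,
      Nat.choose_succ_succ (m + (k + 1)) k, show m + 1 + k = m + (k + 1) by omega, add_smul,
      add_comm]

variable {M' : Type*} [LieRing M'] [LieAlgebra O M']

/-- The operator on power series attached to an element of an ideal of corank one on whose
complement a derivation `δ` is given. -/
def seqAction (ρ : M' →ₗ⁅O⁆ Module.End O V) (δ : LieDerivation O M' M') (N : ℕ) :
    M' →ₗ[O] Module.End O (ℕ → V) :=
  ∑ k ∈ Finset.range N, (-1 : ℤ) ^ k • hasseOp k ∘ₗ (ρ : M' →ₗ[O] Module.End O V) ∘ₗ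
    (δ : M' →ₗ[O] M') ^ k

variable (ρ : M' →ₗ⁅O⁆ Module.End O V) (δ : LieDerivation O M' M') (N : ℕ)

theorem seqAction_apply (h : M') :
    seqAction ρ δ N h = ∑ k ∈ Finset.range N, (-1 : ℤ) ^ k • hasseOp k (ρ (δ^[k] h)) := by
  simp only [seqAction, LinearMap.sum_apply, LinearMap.smul_apply, LinearMap.comp_apply,
    Module.End.pow_apply]
  rfl

theorem seqAction_apply_apply (h : M') (f : ℕ → V) (m : ℕ) :
    seqAction ρ δ N h f m =
      ∑ k ∈ Finset.range N, (-1 : ℤ) ^ k • (m + k).choose k • ρ (δ^[k] h) (f (m + k)) := by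
  rw [seqAction_apply]
  simp only [LinearMap.sum_apply, Finset.sum_apply, LinearMap.smul_apply, Pi.smul_apply,
    hasseOp_apply]

variable {N}

theorem iterate_eq_zero_of_le (hN : ∀ h, δ^[N] h = 0) {k : ℕ} (hk : N ≤ k) (h : M') :
    δ^[k] h = 0 := by
  rw [← Nat.add_sub_cancel' hk, add_comm, Function.iterate_add_apply, hN]
  exact Function.iterate_fixed (map_zero δ) _

/-- Bracketing with X lowers the order of each divided power by one, and the alternating sign
absorbs the minus sign. The shifted sum lacks only its term of order N - 1, which contains δ^N h =
0. -/
theorem lie_shiftOp_seqAction (hN : ∀ h, δ^[N] h = 0) (h : M') :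
    ⁅(shiftOp : Module.End O (ℕ → V)), seqAction ρ δ N h⁆ = seqAction ρ δ N (δ h) := by
  rcases N with _ | N
  · simp [seqAction]
  rw [seqAction_apply, seqAction_apply, Finset.sum_range_succ', lie_add, Finset.sum_range_succ]
  rw [lie_smul, lie_shiftOp_hasseOp_zero, ← Function.iterate_succ_apply, hN, lie_sum]
  simp only [lie_smul, lie_shiftOp_hasseOp_succ, map_zero, smul_zero, add_zero]
  refine Finset.sum_congr rfl fun k _ => ?_
  rw [pow_succ, mul_neg_one, neg_smul, smul_neg, neg_neg, Function.iterate_succ_apply]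

/-- The Leibniz expansion of δ^m [a, b] carries exactly the binomial coefficients that arise when
divided powers of ∂ are composed, so the two double sums agree when grouped by total order. -/
theorem lie_seqAction (hN : ∀ h, δ^[N] h = 0) (a b : M') :
    ⁅seqAction ρ δ N a, seqAction ρ δ N b⁆ = seqAction ρ δ N ⁅a, b⁆ := by
  have h1 : seqAction ρ δ N ⁅a, b⁆ =
      ∑ k ∈ Finset.range (N + N), (-1 : ℤ) ^ k • hasseOp k (ρ (δ^[k] ⁅a, b⁆)) := by
    rw [seqAction_apply]
    refine Finset.sum_subset (Finset.range_mono (by omega)) fun k _ hk => ?_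
    rw [iterate_eq_zero_of_le δ hN (by simpa using hk)]
    simp
  rw [h1, seqAction_apply, seqAction_apply, sum_lie_sum_product, ← Finset.sum_product',
    ← Finset.sum_fiberwise_of_maps_to (t := Finset.range (N + N)) (g := fun p => p.1 + p.2)]
  · refine Finset.sum_congr rfl fun m _ => ?_
    rw [LieDerivation.iterate_apply_lie, map_sum, map_sum, Finset.smul_sum]
    have hs : {p ∈ Finset.range N ×ˢ Finset.range N | p.1 + p.2 = m} ⊆
        Finset.HasAntidiagonal.antidiagonal m := by
      intro p hp
      rw [Finset.mem_filter] at hp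
      exact Finset.HasAntidiagonal.mem_antidiagonal.2 hp.2
    refine (Finset.sum_congr rfl fun p hp => ?_).trans (Finset.sum_subset hs fun p hp hp' => ?_)
    · have h2 := (Finset.mem_filter.1 hp).2
      rw [smul_lie, lie_smul, lie_hasseOp, smul_smul, ← pow_add, h2, map_nsmul, map_nsmul,
        LieHom.map_lie]
    · rw [Finset.HasAntidiagonal.mem_antidiagonal] at hp
      -- The pairs missing from the square of side N contribute zero, as one of the iterated
      -- derivatives vanishes.
      have h3 : N ≤ p.1 ∨ N ≤ p.2 := by
        by_contra! h
        exact hp' (Finset.mem_filter.2 ⟨by simp [h.1, h.2], hp⟩)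
      rcases h3 with h | h <;> rw [iterate_eq_zero_of_le δ hN h] <;> simp
  · intro p hp
    simp only [Finset.mem_product, Finset.mem_range] at hp ⊢
    omega

end Sequences

/-- `M` is the sum of `O x` and of (the image under `i` of) an ideal `M'` on which `ad x` acts as
the derivation `δ`; the projections are `μ` and `η`. -/
structure IsSplitExtension {O : Type*} [CommRing O] {M' M : Type*} [LieRing M'] [LieAlgebra O M']
    [LieRing M] [LieAlgebra O M] (i : M' →ₗ⁅O⁆ M) (x : M) (δ : LieDerivation O M' M')
    (μ : M →ₗ[O] O) (η : M →ₗ[O] M') : Prop where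
  injective : Function.Injective i
  map_derivation : ∀ h, i (δ h) = ⁅x, i h⁆
  decomposition : ∀ m, m = μ m • x + i (η m)
  coord_ideal : ∀ h, μ (i h) = 0
  coord_generator : μ x = 1

namespace IsSplitExtension

variable {O : Type*} [CommRing O] {M' M : Type*} [LieRing M'] [LieAlgebra O M']
  [LieRing M] [LieAlgebra O M] {i : M' →ₗ⁅O⁆ M} {x : M} {δ : LieDerivation O M' M'}
  {μ : M →ₗ[O] O} {η : M →ₗ[O] M'} (hS : IsSplitExtension i x δ μ η)

include hS

theorem proj_ideal (h : M') : η (i h) = h := by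
  have h1 := hS.decomposition (i h)
  rw [hS.coord_ideal, zero_smul, zero_add] at h1
  exact (hS.injective h1).symm

theorem proj_generator : η x = 0 := by
  have h1 := hS.decomposition x
  rw [hS.coord_generator, one_smul, left_eq_add] at h1
  exact hS.injective (h1.trans (map_zero i).symm)

theorem lie_eq (a b : M) :
    ⁅a, b⁆ = i (μ a • δ (η b) - μ b • δ (η a) + ⁅η a, η b⁆) := by
  rw [map_add, map_sub, map_smul, map_smul, hS.map_derivation, hS.map_derivation, LieHom.map_lie]
  conv_lhs => rw [hS.decomposition a, hS.decomposition b]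
  simp only [add_lie, lie_add, smul_lie, lie_smul, lie_self, smul_zero]
  rw [← lie_skew x (i (η a))]
  simp only [smul_neg]
  abel_nf

/-- The induced representation on power series. -/
def inducedHom {V : Type*} [AddCommGroup V] [Module O V] (ρ : M' →ₗ⁅O⁆ Module.End O V) {N : ℕ}
    (hN : ∀ h, δ^[N] h = 0) : M →ₗ⁅O⁆ Module.End O (ℕ → V) where
  __ := μ.smulRight (shiftOp : Module.End O (ℕ → V)) + seqAction ρ δ N ∘ₗ η
  map_lie' {a b} := by
    change μ ⁅a, b⁆ • shiftOp + seqAction ρ δ N (η ⁅a, b⁆) =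
      ⁅μ a • shiftOp + seqAction ρ δ N (η a), μ b • shiftOp + seqAction ρ δ N (η b)⁆
    rw [hS.lie_eq, hS.coord_ideal, hS.proj_ideal, zero_smul, zero_add]
    refine Eq.trans ?_ (lie_smul_add_smul_add (μ a) (μ b) shiftOp (seqAction ρ δ N (η a))
      (seqAction ρ δ N (η b))).symm
    rw [lie_shiftOp_seqAction ρ δ hN, lie_shiftOp_seqAction ρ δ hN,
      lie_seqAction ρ δ hN, map_add, map_sub, map_smul, map_smul]

end IsSplitExtension

/-! ### Null sequences -/

section NullSequences

variable {O : Type*} [CommRing O] (π : O) (V : Type*) [AddCommGroup V] [Module O V]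

/-- The module of sequences tending to zero `π`-adically. -/
def nullSequences : Submodule O (ℕ → V) where
  carrier := {f | ∀ k : ℕ, ∃ N : ℕ, ∀ n, N ≤ n → ∃ g : V, f n = π ^ k • g}
  add_mem' {a b} ha hb k := by
    obtain ⟨N₁, h₁⟩ := ha k
    obtain ⟨N₂, h₂⟩ := hb k
    refine ⟨max N₁ N₂, fun n hn => ?_⟩
    obtain ⟨g₁, e₁⟩ := h₁ n (le_of_max_le_left hn)
    obtain ⟨g₂, e₂⟩ := h₂ n (le_of_max_le_right hn)
    exact ⟨g₁ + g₂, by rw [Pi.add_apply, e₁, e₂, smul_add]⟩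
  zero_mem' k := ⟨0, fun n _ => ⟨0, by simp⟩⟩
  smul_mem' r a ha k := by
    obtain ⟨N, h⟩ := ha k
    refine ⟨N, fun n hn => ?_⟩
    obtain ⟨g, e⟩ := h n hn
    exact ⟨r • g, by rw [Pi.smul_apply, e, smul_comm]⟩

variable {π V}

theorem nullSequences_ext {f g : nullSequences π V} (h : ∀ n, f.1 n = g.1 n) : f = g :=
  Subtype.ext (funext h)

theorem shiftOp_mem {f : ℕ → V} (hf : f ∈ nullSequences π V) :
    shiftOp (O := O) f ∈ nullSequences π V := by
  intro k
  obtain ⟨N, h⟩ := hf k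
  refine ⟨N + 1, fun n hn => ?_⟩
  obtain ⟨n, rfl⟩ : ∃ m, n = m + 1 := ⟨n - 1, by omega⟩
  exact h n (by omega)

theorem hasseOp_mem (j : ℕ) (T : Module.End O V) {f : ℕ → V} (hf : f ∈ nullSequences π V) :
    hasseOp j T f ∈ nullSequences π V := by
  intro k
  obtain ⟨N, h⟩ := hf k
  refine ⟨N, fun n hn => ?_⟩
  obtain ⟨g, e⟩ := h (n + j) (by omega)
  exact ⟨(n + j).choose j • T g, by rw [hasseOp_apply, e, map_smul, smul_comm]⟩

variable {M' M : Type*} [LieRing M'] [LieAlgebra O M'] [LieRing M] [LieAlgebra O M]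
  {i : M' →ₗ⁅O⁆ M} {x : M} {δ : LieDerivation O M' M'} {μ : M →ₗ[O] O} {η : M →ₗ[O] M'}
  (hS : IsSplitExtension i x δ μ η) (ρ : M' →ₗ⁅O⁆ Module.End O V) {N : ℕ}
  (hN : ∀ h, δ^[N] h = 0)

theorem inducedHom_apply (m : M) :
    hS.inducedHom ρ hN m = μ m • shiftOp + seqAction ρ δ N (η m) := rfl

theorem inducedHom_mem (m : M) {f : ℕ → V} (hf : f ∈ nullSequences π V) :
    hS.inducedHom ρ hN m f ∈ nullSequences π V := by
  rw [inducedHom_apply, seqAction_apply]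
  simp only [LinearMap.add_apply, LinearMap.smul_apply, LinearMap.sum_apply]
  refine add_mem (Submodule.smul_mem _ _ (shiftOp_mem hf)) (sum_mem fun k _ => ?_)
  exact zsmul_mem (hasseOp_mem k _ hf) _

/-- The completed induced representation, on null sequences. -/
def nullHom : M →ₗ⁅O⁆ Module.End O (nullSequences π V) where
  toFun m := (hS.inducedHom ρ hN m).restrict fun _ hf => inducedHom_mem hS ρ hN m hf
  map_add' a b := by
    ext f : 2
    change hS.inducedHom ρ hN (a + b) f.1 = _
    rw [map_add]
    rfl
  map_smul' a b := by
    ext f : 2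
    change hS.inducedHom ρ hN (a • b) f.1 = _
    rw [map_smul]
    rfl
  map_lie' {a b} := by
    ext f : 2
    change hS.inducedHom ρ hN ⁅a, b⁆ f.1 = _
    rw [LieHom.map_lie]
    rfl

theorem nullHom_generator_zero (f : nullSequences π V) : (nullHom hS ρ hN x f).1 0 = 0 := by
  change (μ x • shiftOp + seqAction ρ δ N (η x) : Module.End O (ℕ → V)) f.1 0 = 0
  rw [hS.coord_generator, hS.proj_generator, map_zero, one_smul, add_zero, shiftOp_zero]

theorem nullHom_generator_succ (f : nullSequences π V) (m : ℕ) :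
    (nullHom hS ρ hN x f).1 (m + 1) = f.1 m := by
  change (μ x • shiftOp + seqAction ρ δ N (η x) : Module.End O (ℕ → V)) f.1 (m + 1) = _
  rw [hS.coord_generator, hS.proj_generator, map_zero, one_smul, add_zero, shiftOp_succ]

theorem nullHom_ideal (h : M') (f : nullSequences π V) (m : ℕ) :
    (nullHom hS ρ hN (i h) f).1 m =
      ∑ k ∈ Finset.range N, (-1 : ℤ) ^ k • (m + k).choose k • ρ (δ^[k] h) (f.1 (m + k)) := by
  change (μ (i h) • shiftOp + seqAction ρ δ N (η (i h)) : Module.End O (ℕ → V)) f.1 m = _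
  rw [hS.coord_ideal, hS.proj_ideal, zero_smul, zero_add, seqAction_apply_apply]

/-- The sequence with the single entry `w` in place `n`. -/
def nullSingle (n : ℕ) : V →ₗ[O] nullSequences π V :=
  (LinearMap.single O (fun _ => V) n).codRestrict _ fun w k => ⟨n + 1, fun m hm => ⟨0, by
    rw [smul_zero]
    exact Pi.single_eq_of_ne (M := fun _ => V) (by omega : m ≠ n) w⟩⟩

theorem nullSingle_apply (n m : ℕ) (w : V) :
    (nullSingle n w : nullSequences π V).1 m = if m = n then w else 0 := by
  change Pi.single (M := fun _ => V) n w m = _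
  rw [Pi.single_apply]

theorem nullHom_generator_single (n : ℕ) (w : V) :
    nullHom hS ρ hN x (nullSingle n w : nullSequences π V) = nullSingle (n + 1) w := by
  refine nullSequences_ext fun m => ?_
  rcases m with _ | m
  · rw [nullHom_generator_zero, nullSingle_apply, if_neg (by omega)]
  · rw [nullHom_generator_succ, nullSingle_apply, nullSingle_apply]
    simp

/-- A constant is killed by every ∂^k/k! with k > 0, so V embeds as the constants, compatibly with
the ideal. -/
theorem nullHom_ideal_single (h : M') (w : V) :
    nullHom hS ρ hN (i h) (nullSingle 0 w : nullSequences π V) = nullSingle 0 (ρ h w) := by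
  refine nullSequences_ext fun m => ?_
  rw [nullHom_ideal]
  rcases N with _ | N
  · simp [show h = 0 from hN h]
  rw [Finset.sum_range_succ', Finset.sum_eq_zero fun k _ => ?_]
  · rw [nullSingle_apply, nullSingle_apply]
    split_ifs with h0 h1 h1
    · simp
    · exact absurd h0 h1
    · exact absurd h1 h0
    · simp
  · rw [nullSingle_apply, if_neg (by omega), map_zero, smul_zero, smul_zero]

/-- A null sequence with all entries divisible by `π ^ n` is divisible by `π ^ n`. -/
theorem nullSequences_exists_smul (hV : PiComplete π V) (f : nullSequences π V) (n : ℕ)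
    (h : ∀ m, ∃ w : V, f.1 m = π ^ n • w) : ∃ g : nullSequences π V, f = π ^ n • g := by
  choose w hw using h
  refine ⟨⟨w, fun k => ?_⟩, nullSequences_ext hw⟩
  obtain ⟨N, hN⟩ := f.2 (n + k)
  refine ⟨N, fun m hm => ?_⟩
  obtain ⟨g, hg⟩ := hN m hm
  refine ⟨g, ?_⟩
  rw [← sub_eq_zero]
  refine hV.pow_torsionFree n ?_
  rw [smul_sub, ← hw, hg, pow_add, mul_smul, sub_self]

theorem nullSequences_piComplete (hV : PiComplete π V) : PiComplete π (nullSequences π V) where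
  torsionFree f h := nullSequences_ext fun n => hV.torsionFree _ (congrFun (congrArg Subtype.val h) n)
  separated f h := nullSequences_ext fun n => hV.separated _ fun k => by
    obtain ⟨w, rfl⟩ := h k
    exact ⟨w.1 n, rfl⟩
  series a := by
    choose l hl using fun m => hV.series fun j => (a j).1 m
    choose w hw using hl
    -- Modulo π^k the entrywise limit agrees with the sum of the first k terms, which is a null
    -- sequence.
    have hmem : l ∈ nullSequences π V := by
      intro k
      obtain ⟨N, hN⟩ := (∑ j ∈ Finset.range k, π ^ j • a j).2 k
      refine ⟨N, fun m hm => ?_⟩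
      obtain ⟨g, hg⟩ := hN m hm
      refine ⟨w m k + g, ?_⟩
      rw [smul_add, ← hw, ← hg]
      simp [Finset.sum_apply]
    refine ⟨⟨l, hmem⟩, fun n => nullSequences_exists_smul hV _ n fun m => ⟨w m n, ?_⟩⟩
    rw [← hw]
    simp [Finset.sum_apply]

end NullSequences

/-! ### Models of Dixmier modules -/

section EnvelopingAlgebra

variable {O : Type*} [CommRing O] {M : Type*} [LieRing M] [LieAlgebra O M]

open UniversalEnvelopingAlgebra in
-- The elements with property P form a subalgebra containing the image of M; by the universal
-- property the identity factors through it.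
theorem envelope_induction {P : UniversalEnvelopingAlgebra O M → Prop}
    (hr : ∀ r : O, P (algebraMap O _ r)) (hι : ∀ m : M, P (ι O m))
    (hmul : ∀ a b, P a → P b → P (a * b)) (hadd : ∀ a b, P a → P b → P (a + b))
    (a : UniversalEnvelopingAlgebra O M) : P a := by
  let S : Subalgebra O (UniversalEnvelopingAlgebra O M) :=
    { carrier := {a | P a}
      mul_mem' := fun ha hb => hmul _ _ ha hb
      add_mem' := fun ha hb => hadd _ _ ha hb
      algebraMap_mem' := hr }
  let F : M →ₗ⁅O⁆ S :=
    { toFun := fun m => ⟨ι O m, hι m⟩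
      map_add' := fun a b => Subtype.ext (map_add (ι O) a b)
      map_smul' := fun r a => Subtype.ext (map_smul (ι O) r a)
      map_lie' := fun {a b} => Subtype.ext (LieHom.map_lie (ι O) a b) }
  have h : S.val.comp (lift O F) = AlgHom.id O _ := by
    refine UniversalEnvelopingAlgebra.hom_ext O (LieHom.ext fun m => ?_)
    change S.val (lift O F (ι O m)) = ι O m
    rw [lift_ι_apply]
    rfl
  rw [← AlgHom.id_apply (R := O) a, ← h]
  exact (lift O F a).2

variable {V : Type*} [AddCommGroup V] [Module O V] (ρ : M →ₗ⁅O⁆ Module.End O V)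

theorem lift_mem_of_stable (W : Submodule O V) (hW : ∀ m, ∀ f ∈ W, ρ m f ∈ W)
    (u : UniversalEnvelopingAlgebra O M) : ∀ f ∈ W, UniversalEnvelopingAlgebra.lift O ρ u f ∈ W := by
  refine envelope_induction (P := fun u => ∀ f ∈ W, UniversalEnvelopingAlgebra.lift O ρ u f ∈ W)
    (fun r f hf => ?_) (fun m f hf => ?_) (fun a b ha hb f hf => ?_)
    (fun a b ha hb f hf => ?_) u
  · rw [AlgHom.commutes, Module.algebraMap_end_apply]
    exact W.smul_mem _ hf
  · rw [UniversalEnvelopingAlgebra.lift_ι_apply]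
    exact hW m f hf
  · rw [map_mul]
    exact ha _ (hb _ hf)
  · rw [map_add]
    exact W.add_mem (ha _ hf) (hb _ hf)

/-- The left ideal generated by the elements `m - χ m` for `m ∈ B`. -/
def charIdeal (B : Set M) (χ : M →ₗ[O] O) : Ideal (UniversalEnvelopingAlgebra O M) :=
  Ideal.span {a | ∃ m ∈ B, a = UniversalEnvelopingAlgebra.ι O m - algebraMap O _ (χ m)}

/-- A complete model of the Dixmier module attached to the character `χ` of `B`, with canonical
generator `v`. -/
structure IsDixmierModel (π : O) (B : Set M) (χ : M →ₗ[O] O) (v : V) : Prop where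
  complete : PiComplete π V
  eigen : ∀ m ∈ B, ρ m v = χ m • v
  dense : ∀ f : V, ∃ (u : UniversalEnvelopingAlgebra O M) (g : V),
    f = UniversalEnvelopingAlgebra.lift O ρ u v + π • g
  kernel : ∀ u : UniversalEnvelopingAlgebra O M,
    (∃ w : V, UniversalEnvelopingAlgebra.lift O ρ u v = π • w) →
      u ∈ charIdeal B χ ⊔ powIdeal π (UniversalEnvelopingAlgebra O M) 1
  irreducible : ∀ f : V, f ≠ 0 → ∃ (u : UniversalEnvelopingAlgebra O M) (k : ℕ) (w : V),
    UniversalEnvelopingAlgebra.lift O ρ u f = π ^ k • (v + π • w)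
  functional : ∃ ε : V →ₗ[O] O, ε v = 1

variable {ρ} {π : O} {B : Set M} {χ : M →ₗ[O] O} {v : V}

/-- Elements that are central modulo the kernel of `χ` act by scalars. -/
theorem IsDixmierModel.scalar (h : IsDixmierModel ρ π B χ v) (E : Set M)
    (hE : ∀ e ∈ E, ∀ m, ⁅e, m⁆ ∈ E ∧ χ ⁅e, m⁆ = 0) (hEB : E ⊆ B) {e : M} (he : e ∈ E) (f : V) :
    ρ e f = χ e • f := by
  -- The common eigenvectors of E with eigencharacter χ form an M-stable submodule, because χ
  -- vanishes on [e, m] ∈ E. It contains v, hence U(M)v, which is dense in V.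
  let W : Submodule O V :=
    { carrier := {f | ∀ e ∈ E, ρ e f = χ e • f}
      add_mem' := fun {a b} ha hb e he => by rw [map_add, ha e he, hb e he, smul_add]
      zero_mem' := fun e _ => by rw [map_zero, smul_zero]
      smul_mem' := fun r a ha e he => by rw [map_smul, ha e he, smul_comm] }
  have hW : ∀ m, ∀ f ∈ W, ρ m f ∈ W := by
    intro m f hf e he
    have h1 : ρ ⁅e, m⁆ f = 0 := by rw [hf _ (hE e he m).1, (hE e he m).2, zero_smul]
    rw [LieHom.map_lie, Ring.lie_def, LinearMap.sub_apply, sub_eq_zero] at h1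
    exact h1.trans (by rw [Module.End.mul_apply, hf e he, map_smul])
  have hv : v ∈ W := fun e he => h.eigen e (hEB he)
  have key : ∀ (n : ℕ) (f : V), ∃ w : V, ρ e f - χ e • f = π ^ n • w := by
    intro n
    induction n with
    | zero => exact fun f => ⟨_, by rw [pow_zero, one_smul]⟩
    | succ n ih =>
      intro f
      obtain ⟨u, g, rfl⟩ := h.dense f
      obtain ⟨w, hw⟩ := ih g
      refine ⟨w, ?_⟩
      rw [map_add, lift_mem_of_stable ρ W hW u v hv e he, map_smul, pow_succ', mul_smul, ← hw,
        smul_add, smul_sub, smul_comm π]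
      abel
  rw [← sub_eq_zero]
  exact h.complete.separated _ fun n => key n f

/-- The one-dimensional model, for a character of the whole Lie algebra. -/
theorem exists_scalar_model (hO : PiComplete π O)
    (hfac : ∀ r : O, r ≠ 0 → ∃ (s : O) (k : ℕ), s * r = π ^ k) (hχ : ∀ a b : M, χ ⁅a, b⁆ = 0) :
    ∃ ρ : M →ₗ⁅O⁆ Module.End O O, IsDixmierModel ρ π Set.univ χ (1 : O) := by
  let ρ : M →ₗ⁅O⁆ Module.End O O :=
    { __ := χ.smulRight (1 : Module.End O O)
      map_lie' := fun {a b} => by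
        change χ ⁅a, b⁆ • (1 : Module.End O O) =
          (χ a • (1 : Module.End O O)) * (χ b • 1) - (χ b • (1 : Module.End O O)) * (χ a • 1)
        rw [hχ, zero_smul, smul_mul_smul_comm, smul_mul_smul_comm, mul_comm, sub_self] }
  have hρ : ∀ m r, ρ m r = χ m • r := fun m r => rfl
  refine ⟨ρ, hO, fun m _ => hρ m 1, fun f => ⟨algebraMap O _ f, 0, ?_⟩, ?_, ?_, ⟨LinearMap.id, rfl⟩⟩
  · rw [AlgHom.commutes, Module.algebraMap_end_apply]
    simp
  · have key : ∀ u : UniversalEnvelopingAlgebra O M, ∃ r : O,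
        UniversalEnvelopingAlgebra.lift O ρ u = algebraMap O _ r ∧
          u - algebraMap O _ r ∈ charIdeal Set.univ χ := by
      refine envelope_induction (fun r => ⟨r, AlgHom.commutes _ _, ?_⟩)
        (fun m => ⟨χ m, ?_, ?_⟩) ?_ ?_
      · rw [sub_self]
        exact zero_mem _
      · rw [UniversalEnvelopingAlgebra.lift_ι_apply]
        rfl
      · exact Ideal.subset_span ⟨m, Set.mem_univ m, rfl⟩
      · rintro a b ⟨r, hr, hr'⟩ ⟨s, hs, hs'⟩
        refine ⟨r * s, by rw [map_mul, map_mul, hr, hs], ?_⟩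
        have e : a * b - algebraMap O _ (r * s) =
            a * (b - algebraMap O _ s) + algebraMap O _ s * (a - algebraMap O _ r) := by
          rw [mul_sub, mul_sub, map_mul, ← Algebra.commutes s a, ← Algebra.commutes s]
          abel
        rw [e]
        exact add_mem (Ideal.mul_mem_left _ _ hs') (Ideal.mul_mem_left _ _ hr')
      · rintro a b ⟨r, hr, hr'⟩ ⟨s, hs, hs'⟩
        refine ⟨r + s, by rw [map_add, map_add, hr, hs], ?_⟩
        rw [map_add, add_sub_add_comm]
        exact add_mem hr' hs'
    rintro u ⟨w, hw⟩
    obtain ⟨r, hr, hr'⟩ := key u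
    rw [hr, Module.algebraMap_end_apply, smul_eq_mul, mul_one] at hw
    rw [← sub_add_cancel u (algebraMap O _ r)]
    refine add_mem (Ideal.mem_sup_left hr') (Ideal.mem_sup_right ((mem_powIdeal π).2 ?_))
    exact ⟨algebraMap O _ w, by rw [hw, pow_one, smul_eq_mul, map_mul, Algebra.smul_def]⟩
  · intro f hf
    obtain ⟨s, k, hs⟩ := hfac f hf
    refine ⟨algebraMap O _ s, k, 0, ?_⟩
    rw [AlgHom.commutes, Module.algebraMap_end_apply, smul_eq_mul, hs]
    simp

end EnvelopingAlgebra

/-! ### The inductive step -/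

section InductiveStep

variable {O : Type*} [CommRing O] {π : O} {V : Type*} [AddCommGroup V] [Module O V]
  {M' M : Type*} [LieRing M'] [LieAlgebra O M'] [LieRing M] [LieAlgebra O M]
  {i : M' →ₗ⁅O⁆ M} {x : M} {δ : LieDerivation O M' M'} {μ : M →ₗ[O] O} {η : M →ₗ[O] M'}

open UniversalEnvelopingAlgebra (ι lift lift_ι_apply)

/-- The map `∑ u_n ↦ ∑ x ^ n u_n`. -/
def powerExpansion (i : M' →ₗ⁅O⁆ M) (x : M) :
    (ℕ →₀ UniversalEnvelopingAlgebra O M') →ₗ[O] UniversalEnvelopingAlgebra O M :=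
  Finsupp.lsum O fun n => LinearMap.mulLeft O (ι O x ^ n) ∘ₗ (envelopingMap i).toLinearMap

theorem powerExpansion_single (n : ℕ) (u : UniversalEnvelopingAlgebra O M') :
    powerExpansion i x (Finsupp.single n u) = ι O x ^ n * envelopingMap i u := by
  simp [powerExpansion]

theorem envelopingMap_ι (h : M') : envelopingMap i (ι O h) = ι O (i h) :=
  lift_ι_apply O _ h

theorem generator_mul_mem {a : UniversalEnvelopingAlgebra O M}
    (ha : a ∈ LinearMap.range (powerExpansion i x)) :
    ι O x * a ∈ LinearMap.range (powerExpansion i x) := by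
  obtain ⟨f, rfl⟩ := ha
  induction f using Finsupp.induction_linear with
  | zero => simp
  | add f g hf hg =>
    rw [map_add, mul_add]
    exact add_mem hf hg
  | single n u =>
    rw [powerExpansion_single, ← mul_assoc, ← pow_succ', ← powerExpansion_single]
    exact ⟨_, rfl⟩

/-- Induction on the exponent, by the commutation rule hx = xh - δ(h); h stays general because δ(h)
takes its place. -/
theorem ideal_mul_mem (hS : IsSplitExtension i x δ μ η) (h : M')
    {a : UniversalEnvelopingAlgebra O M} (ha : a ∈ LinearMap.range (powerExpansion i x)) :
    ι O (i h) * a ∈ LinearMap.range (powerExpansion i x) := by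
  obtain ⟨f, rfl⟩ := ha
  induction f using Finsupp.induction_linear with
  | zero => simp
  | add f g hf hg =>
    rw [map_add, mul_add]
    exact add_mem hf hg
  | single n u =>
    rw [powerExpansion_single]
    induction n generalizing h with
    | zero =>
      rw [pow_zero, one_mul, ← envelopingMap_ι, ← map_mul]
      exact ⟨Finsupp.single 0 (ι O h * u), by rw [powerExpansion_single, pow_zero, one_mul]⟩
    | succ n ih =>
      have e : ι O (i h) * (ι O x ^ (n + 1) * envelopingMap i u) =
          ι O x * (ι O (i h) * (ι O x ^ n * envelopingMap i u)) -
            ι O (i (δ h)) * (ι O x ^ n * envelopingMap i u) := by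
        rw [hS.map_derivation, LieHom.map_lie, Ring.lie_def, pow_succ']
        noncomm_ring
      rw [e]
      exact sub_mem (generator_mul_mem (ih h)) (ih (δ h))

/-- The spanning half of the Poincaré–Birkhoff–Witt theorem relative to the ideal. Uniqueness of the
expansion is never needed. -/
theorem powerExpansion_surjective (hS : IsSplitExtension i x δ μ η) :
    Function.Surjective (powerExpansion i x) := by
  have key : ∀ a b, b ∈ LinearMap.range (powerExpansion i x) →
      a * b ∈ LinearMap.range (powerExpansion i x) := by
    refine envelope_induction (fun r b hb => ?_) (fun m b hb => ?_) (fun a b ha hb c hc => ?_)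
      fun a b ha hb c hc => ?_
    · rw [← Algebra.smul_def]
      exact Submodule.smul_mem _ _ hb
    · rw [hS.decomposition m, map_add, map_smul, add_mul, smul_mul_assoc]
      exact add_mem (Submodule.smul_mem _ _ (generator_mul_mem hb)) (ideal_mul_mem hS _ hb)
    · rw [mul_assoc]
      exact ha _ (hb _ hc)
    · rw [add_mul]
      exact add_mem (ha _ hc) (hb _ hc)
  intro a
  rw [← mul_one a]
  refine key a 1 ⟨Finsupp.single 0 1, ?_⟩
  rw [powerExpansion_single, pow_zero, one_mul, map_one]

variable (hS : IsSplitExtension i x δ μ η) (ρ : M' →ₗ⁅O⁆ Module.End O V) {N : ℕ}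
  (hN : ∀ h, δ^[N] h = 0)

theorem lift_nullHom_envelopingMap (u : UniversalEnvelopingAlgebra O M') : ∀ w : V,
    lift O (nullHom hS ρ hN) (envelopingMap i u) (nullSingle 0 w : nullSequences π V) =
      nullSingle 0 (lift O ρ u w) := by
  refine envelope_induction (P := fun u => ∀ w : V,
    lift O (nullHom hS ρ hN) (envelopingMap i u) (nullSingle 0 w : nullSequences π V) =
      nullSingle 0 (lift O ρ u w)) (fun r w => ?_) (fun m w => ?_) (fun a b ha hb w => ?_)
    (fun a b ha hb w => ?_) u
  · simp only [AlgHom.commutes, Module.algebraMap_end_apply, map_smul]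
  · rw [envelopingMap_ι, lift_ι_apply, lift_ι_apply, nullHom_ideal_single]
  · rw [map_mul, map_mul, map_mul, Module.End.mul_apply, hb, ha, Module.End.mul_apply]
  · rw [map_add, map_add, map_add, LinearMap.add_apply, ha, hb, LinearMap.add_apply, map_add]

theorem lift_nullHom_pow (n : ℕ) (w : V) :
    lift O (nullHom hS ρ hN) (ι O x ^ n) (nullSingle 0 w : nullSequences π V) = nullSingle n w := by
  induction n with
  | zero => rw [pow_zero, map_one, Module.End.one_apply]
  | succ n ih =>
    rw [pow_succ', map_mul, Module.End.mul_apply, ih, lift_ι_apply, nullHom_generator_single]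

/-- Acting on a constant w, the element ∑ x^n u_n gives ∑ X^n (u_n w), so its coefficients can be
tested separately. The kernel condition for the induced model depends on this. -/
theorem lift_nullHom_powerExpansion (f : ℕ →₀ UniversalEnvelopingAlgebra O M') (w : V) (m : ℕ) :
    (lift O (nullHom hS ρ hN) (powerExpansion i x f) (nullSingle 0 w : nullSequences π V)).1 m =
      lift O ρ (f m) w := by
  induction f using Finsupp.induction_linear with
  | zero => simp
  | add f g hf hg =>
    rw [map_add, map_add, LinearMap.add_apply, Submodule.coe_add, Pi.add_apply, hf, hg,
      Finsupp.add_apply, map_add, LinearMap.add_apply]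
  | single n u =>
    rw [powerExpansion_single, map_mul, Module.End.mul_apply, lift_nullHom_envelopingMap,
      lift_nullHom_pow, nullSingle_apply, Finsupp.single_apply]
    simp only [eq_comm (a := n)]
    split_ifs <;> simp

end InductiveStep

/-! ### Lowering and cutoff operators; irreducibility of the induced model -/

section Induction

variable {O : Type*} [CommRing O] {π : O} {V : Type*} [AddCommGroup V] [Module O V]
  {M' M : Type*} [LieRing M'] [LieAlgebra O M'] [LieRing M] [LieAlgebra O M]
  {i : M' →ₗ⁅O⁆ M} {x : M} {δ : LieDerivation O M' M'} {μ : M →ₗ[O] O} {η : M →ₗ[O] M'}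

open UniversalEnvelopingAlgebra (ι lift lift_ι_apply)

variable (hS : IsSplitExtension i x δ μ η) {ρ : M' →ₗ⁅O⁆ Module.End O V} {N : ℕ}

/-- If `y`, `[x, y]` act by scalars and `[x, [x, y]]` by zero, then `y` acts on power series as a
first order differential operator. -/
theorem nullHom_lowering (hN : ∀ h, δ^[N + 2] h = 0) {y : M'} {b c : O} (h0 : ∀ f, ρ y f = b • f)
    (h1 : ∀ f, ρ (δ y) f = c • f) (h2 : ∀ k f, ρ (δ^[k + 2] y) f = 0) (f : nullSequences π V)
    (m : ℕ) : (nullHom hS ρ hN (i y) f).1 m = b • f.1 m - (((m + 1 : ℕ) : O) * c) • f.1 (m + 1) := by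
  rw [nullHom_ideal, Finset.sum_range_succ', Finset.sum_range_succ',
    Finset.sum_eq_zero fun k _ => by rw [h2, smul_zero, smul_zero]]
  simp only [Function.iterate_zero, Function.iterate_succ, Function.comp_apply, id_eq, h0, h1,
    add_zero, zero_add, pow_zero, pow_one, one_smul, Nat.choose_zero_right, Nat.choose_one_right,
    neg_smul, mul_smul, Nat.cast_smul_eq_nsmul]
  abel

/-- The values `∏ (j - m) / j`, for `1 ≤ j ≤ N`. -/
def cutoff (N m : ℕ) : ℤ := if m = 0 then 1 else (-1) ^ N * ((m - 1).choose N : ℤ)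

theorem cutoff_succ (N m : ℕ) : ((N + 1 : ℕ) : ℤ) * cutoff (N + 1) m =
    (((N + 1 : ℕ) : ℤ) - m) * cutoff N m := by
  rcases m with _ | m
  · simp [cutoff]
  · have h := Nat.choose_succ_right_eq m N
    simp only [cutoff, if_neg (Nat.succ_ne_zero m), Nat.add_sub_cancel]
    rcases le_or_gt N m with hNm | hNm
    · have h' : (m.choose (N + 1) : ℤ) * (N + 1) = m.choose N * (m - N) := by
        have := congrArg (Nat.cast (R := ℤ)) h
        push_cast [Nat.cast_sub hNm] at this
        exact this
      push_cast
      linear_combination (-1) ^ (N + 1) * h'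
    · rw [Nat.choose_eq_zero_of_lt hNm, Nat.choose_eq_zero_of_lt (by omega)]
      simp

theorem cutoff_eq_zero {N m : ℕ} (h : m ≠ 0) (hm : m ≤ N) : cutoff N m = 0 := by
  rw [cutoff, if_neg h, Nat.choose_eq_zero_of_lt (by omega)]
  simp

/-- The operator is the product of the cj + x(y - b) for 1 ≤ j ≤ n. Since x(y - b) acts on the
coefficient of X^m by -cm, each factor acts there by c(j - m). -/
theorem exists_cutoff_operator (hN : ∀ h, δ^[N + 2] h = 0) {y : M'} {b c : O}
    (h0 : ∀ f, ρ y f = b • f) (h1 : ∀ f, ρ (δ y) f = c • f) (h2 : ∀ k f, ρ (δ^[k + 2] y) f = 0)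
    (n : ℕ) : ∃ z : UniversalEnvelopingAlgebra O M, ∀ (f : nullSequences π V) (m : ℕ),
      (lift O (nullHom hS ρ hN) z f).1 m = (c ^ n * (n.factorial : O)) • cutoff n m • f.1 m := by
  induction n with
  | zero =>
    refine ⟨1, fun f m => ?_⟩
    simp [cutoff]
  | succ n ih =>
    obtain ⟨z, hz⟩ := ih
    let e : UniversalEnvelopingAlgebra O M :=
      algebraMap O _ (((n + 1 : ℕ) : O) * c) + ι O x * (ι O (i y) - algebraMap O _ b)
    have he : ∀ (f : nullSequences π V) (m : ℕ), (lift O (nullHom hS ρ hN) e f).1 m =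
        (c * ((((n + 1 : ℕ) : ℤ) - m : ℤ) : O)) • f.1 m := by
      intro f m
      have e1 : lift O (nullHom hS ρ hN) e f = (((n + 1 : ℕ) : O) * c) • f +
          nullHom hS ρ hN x (nullHom hS ρ hN (i y) f - b • f) := by
        simp only [e, map_add, AlgHom.commutes, LinearMap.add_apply, Module.algebraMap_end_apply]
        simp only [map_mul, map_sub, AlgHom.commutes, Module.algebraMap_end_apply,
          Module.End.mul_apply, LinearMap.sub_apply, lift_ι_apply]
      rw [e1]
      rcases m with _ | m
      · rw [Submodule.coe_add, Pi.add_apply, nullHom_generator_zero]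
        simp [mul_comm]
      · rw [Submodule.coe_add, Pi.add_apply, nullHom_generator_succ, Submodule.coe_sub,
          Pi.sub_apply, nullHom_lowering hS hN h0 h1 h2]
        simp only [Submodule.coe_smul, Pi.smul_apply]
        rw [sub_sub_cancel_left, ← neg_smul, ← add_smul]
        congr 1
        push_cast
        ring
    refine ⟨e * z, fun f m => ?_⟩
    rw [map_mul, Module.End.mul_apply, he, hz, smul_smul, ← Int.cast_smul_eq_zsmul O,
      ← Int.cast_smul_eq_zsmul O, smul_smul, smul_smul]
    congr 1
    have h := congrArg (Int.cast (R := O)) (cutoff_succ n m)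
    push_cast at h
    rw [pow_succ, Nat.factorial_succ]
    push_cast
    linear_combination (-(c * c ^ n * (n.factorial : O))) * h

theorem smul_ne_zero_of_piComplete (hV : PiComplete π V)
    (hfac : ∀ r : O, r ≠ 0 → ∃ (s : O) (k : ℕ), s * r = π ^ k) {r : O} (hr : r ≠ 0) {f : V}
    (hf : f ≠ 0) : r • f ≠ 0 := by
  obtain ⟨s, k, hs⟩ := hfac r hr
  intro h
  refine hf (hV.pow_torsionFree k ?_)
  rw [← hs, mul_smul, h, smul_zero]

/-- Repeated application of y - b = -c d/dX brings a nonzero coefficient down to degree 0;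
characteristic zero and c ≠ 0 keep it nonzero. -/
theorem exists_coeff_zero_ne_zero [CharZero O] [IsDomain O] (hV : PiComplete π V)
    (hfac : ∀ r : O, r ≠ 0 → ∃ (s : O) (k : ℕ), s * r = π ^ k)
    (hN : ∀ h, δ^[N + 2] h = 0) {y : M'} {b c : O} (hc : c ≠ 0)
    (h0 : ∀ f, ρ y f = b • f) (h1 : ∀ f, ρ (δ y) f = c • f) (h2 : ∀ k f, ρ (δ^[k + 2] y) f = 0)
    (n : ℕ) : ∀ f : nullSequences π V, f.1 n ≠ 0 → ∃ u : UniversalEnvelopingAlgebra O M,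
      (lift O (nullHom hS ρ hN) u f).1 0 ≠ 0 := by
  induction n with
  | zero => exact fun f hf => ⟨1, by simpa using hf⟩
  | succ n ih =>
    intro f hf
    obtain ⟨u, hu⟩ := ih (lift O (nullHom hS ρ hN) (ι O (i y) - algebraMap O _ b) f) (by
      have e1 : lift O (nullHom hS ρ hN) (ι O (i y) - algebraMap O _ b) f =
          nullHom hS ρ hN (i y) f - b • f := by
        simp only [map_sub, AlgHom.commutes, Module.algebraMap_end_apply, LinearMap.sub_apply,
          lift_ι_apply]
      rw [e1, Submodule.coe_sub, Pi.sub_apply, nullHom_lowering hS hN h0 h1 h2]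
      change b • f.1 n - _ - b • f.1 n ≠ 0
      rw [sub_sub_cancel_left, neg_ne_zero]
      exact smul_ne_zero_of_piComplete hV hfac
        (mul_ne_zero (Nat.cast_ne_zero.2 n.succ_ne_zero) hc) hf)
    exact ⟨u * _, by rw [map_mul]; exact hu⟩

theorem charIdeal_map_le {B' : Set M'} {B : Set M} {χ' : M' →ₗ[O] O} {χ : M →ₗ[O] O}
    (hB : ∀ h ∈ B', i h ∈ B) (hχ : ∀ h, χ (i h) = χ' h)
    {a : UniversalEnvelopingAlgebra O M'}
    (ha : a ∈ charIdeal B' χ' ⊔ powIdeal π (UniversalEnvelopingAlgebra O M') 1) :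
    envelopingMap i a ∈ charIdeal B χ ⊔ powIdeal π (UniversalEnvelopingAlgebra O M) 1 := by
  suffices h : charIdeal B' χ' ⊔ powIdeal π (UniversalEnvelopingAlgebra O M') 1 ≤
      (charIdeal B χ ⊔ powIdeal π (UniversalEnvelopingAlgebra O M) 1).comap
        (envelopingMap i : UniversalEnvelopingAlgebra O M' →+* _) from h ha
  refine sup_le (Ideal.span_le.2 ?_) ?_
  · rintro _ ⟨h, hh, rfl⟩
    refine Ideal.mem_sup_left (Ideal.subset_span ⟨i h, hB h hh, ?_⟩)
    rw [hχ, ← envelopingMap_ι, ← AlgHom.commutes (envelopingMap i)]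
    exact map_sub (envelopingMap i) _ _
  · intro b hb
    exact Ideal.mem_sup_right (powIdeal_le_comap π (envelopingMap i) 1 hb)

/-- Models of Dixmier modules can be induced along ideals of corank one. -/
theorem IsDixmierModel.induced [CharZero O] [IsDomain O]
    (hfac : ∀ r : O, r ≠ 0 → ∃ (s : O) (k : ℕ), s * r = π ^ k) {B' : Set M'} {B : Set M}
    {χ' : M' →ₗ[O] O} {χ : M →ₗ[O] O} {v : V} (hD : IsDixmierModel ρ π B' χ' v)
    (hB : ∀ m, m ∈ B ↔ ∃ h ∈ B', i h = m) (hχ : ∀ h, χ (i h) = χ' h)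
    (hN : ∀ h, δ^[N + 2] h = 0) {y : M'} {b c : O} (hc : c ≠ 0)
    (h0 : ∀ f, ρ y f = b • f) (h1 : ∀ f, ρ (δ y) f = c • f)
    (h2 : ∀ k f, ρ (δ^[k + 2] y) f = 0) :
    IsDixmierModel (nullHom hS ρ hN) π B χ (nullSingle 0 v : nullSequences π V) where
  complete := nullSequences_piComplete hD.complete
  eigen m hm := by
    obtain ⟨h, hh, rfl⟩ := (hB m).1 hm
    rw [nullHom_ideal_single, hD.eigen h hh, hχ, map_smul]
  dense f := by
    have key : ∀ n (w : V), ∃ (u : UniversalEnvelopingAlgebra O M) (g : nullSequences π V),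
        nullSingle n w = lift O (nullHom hS ρ hN) u (nullSingle 0 v) + π • g := by
      intro n w
      obtain ⟨u, g, rfl⟩ := hD.dense w
      refine ⟨ι O x ^ n * envelopingMap i u, nullSingle n g, ?_⟩
      rw [map_mul, Module.End.mul_apply, lift_nullHom_envelopingMap, lift_nullHom_pow, map_add,
        map_smul]
    choose u g hug using key
    -- All entries from n on are divisible by π, so only finitely many have to be approximated.
    obtain ⟨n, hn⟩ := f.2 1
    obtain ⟨r, hr⟩ : ∃ r, f - ∑ j ∈ Finset.range n, nullSingle j (f.1 j) = π ^ 1 • r := by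
      refine nullSequences_exists_smul hD.complete _ 1 fun m => ?_
      have hm : (∑ j ∈ Finset.range n, (nullSingle j (f.1 j) : nullSequences π V)).1 m =
          if m < n then f.1 m else 0 := by
        rw [Submodule.coe_sum, Finset.sum_apply]
        simp only [nullSingle_apply, Finset.sum_ite_eq, Finset.mem_range]
      rw [Submodule.coe_sub, Pi.sub_apply, hm]
      split_ifs with hmn
      · exact ⟨0, by rw [sub_self, smul_zero]⟩
      · rw [sub_zero]
        exact hn m (by omega)
    refine ⟨∑ j ∈ Finset.range n, u j (f.1 j), r + ∑ j ∈ Finset.range n, g j (f.1 j), ?_⟩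
    rw [sub_eq_iff_eq_add, pow_one] at hr
    refine hr.trans ?_
    rw [map_sum, LinearMap.sum_apply, smul_add, Finset.smul_sum,
      Finset.sum_congr rfl fun j _ => hug j (f.1 j), Finset.sum_add_distrib]
    abel
  kernel u := by
    obtain ⟨f, rfl⟩ := powerExpansion_surjective hS u
    rintro ⟨w, hw⟩
    -- Each coefficient u_n sends v into πV, so the kernel condition of V applies to it; left
    -- multiplication by x^n stays in the left ideal.
    rw [powerExpansion, Finsupp.lsum_apply, Finsupp.sum]
    refine sum_mem fun n _ => ?_
    change ι O x ^ n * envelopingMap i (f n) ∈ _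
    refine Ideal.mul_mem_left _ _ ?_
    refine charIdeal_map_le (fun h hh => (hB _).2 ⟨h, hh, rfl⟩) hχ (hD.kernel _ ⟨w.1 n, ?_⟩)
    rw [← lift_nullHom_powerExpansion hS ρ hN, hw]
    rfl
  irreducible f hf := by
    obtain ⟨n, hn⟩ : ∃ n, f.1 n ≠ 0 := by
      by_contra! h
      exact hf (nullSequences_ext h)
    obtain ⟨t, ht⟩ := exists_coeff_zero_ne_zero hS hD.complete hfac hN hc h0 h1 h2 n f hn
    set F := lift O (nullHom hS ρ hN) t f with hF
    obtain ⟨u, k, w, hu⟩ := hD.irreducible _ ht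
    -- The precision k + 1 exceeds the power π^k that reaching v from the constant term will cost,
    -- so the tail still disappears modulo π after division by π^k.
    obtain ⟨n, hn⟩ := F.2 (k + 1)
    obtain ⟨z, hz⟩ := exists_cutoff_operator (π := π) hS hN h0 h1 h2 n
    have hd : c ^ n * (n.factorial : O) ≠ 0 :=
      mul_ne_zero (pow_ne_zero n hc) (Nat.cast_ne_zero.2 n.factorial_ne_zero)
    obtain ⟨s, e, hs⟩ := hfac _ hd
    have hG : (fun m => cutoff n m • F.1 m) ∈ nullSequences π V := by
      intro j
      obtain ⟨n', hn'⟩ := F.2 j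
      refine ⟨n', fun m hm => ?_⟩
      obtain ⟨g, hg⟩ := hn' m hm
      exact ⟨cutoff n m • g, by rw [smul_comm, ← hg]⟩
    obtain ⟨r, hr⟩ : ∃ r, (⟨_, hG⟩ : nullSequences π V) - nullSingle 0 (F.1 0) =
        π ^ (k + 1) • r := by
      refine nullSequences_exists_smul hD.complete _ _ fun m => ?_
      rw [Submodule.coe_sub, Pi.sub_apply, nullSingle_apply]
      change ∃ w, cutoff n m • F.1 m - _ = _
      split_ifs with hm
      · exact ⟨0, by simp [hm, cutoff]⟩
      · rcases le_or_gt m n with hmn | hmn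
        · exact ⟨0, by rw [cutoff_eq_zero hm hmn, zero_smul, sub_zero, smul_zero]⟩
        · obtain ⟨g, hg⟩ := hn m hmn.le
          exact ⟨cutoff n m • g, by rw [hg, sub_zero, smul_comm]⟩
    have hzF : s • lift O (nullHom hS ρ hN) z F =
        π ^ e • (nullSingle 0 (F.1 0) + π ^ (k + 1) • r) := by
      rw [← hr, add_sub_cancel, ← hs, mul_smul]
      congr 1
      exact nullSequences_ext fun m => hz F m
    -- In order of application: t makes the constant term nonzero, z cuts off the intermediate
    -- terms, s turns c^n n! into π^e, and u moves the constant term to π^k(v + πw).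
    refine ⟨s • (envelopingMap i u * z * t), e + k,
      nullSingle 0 w + lift O (nullHom hS ρ hN) (envelopingMap i u) r, ?_⟩
    rw [map_smul, map_mul, map_mul, LinearMap.smul_apply, Module.End.mul_apply,
      Module.End.mul_apply, ← hF, ← map_smul, hzF, map_smul, map_add, lift_nullHom_envelopingMap,
      hu, map_smul]
    simp only [map_smul, map_add, smul_add, smul_smul, pow_add, pow_one, mul_assoc]
    rw [add_assoc]
  functional := by
    obtain ⟨ε, hε⟩ := hD.functional
    refine ⟨ε ∘ₗ LinearMap.proj 0 ∘ₗ (nullSequences π V).subtype, ?_⟩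
    change ε ((nullSingle 0 v : nullSequences π V).1 0) = 1
    rw [nullSingle_apply, if_pos rfl, hε]

end Induction

/-! ### Irreducibility of the affinoid Dixmier module from a model -/

section Irreducibility

/-! ### Modules induced from a character -/

section InducedCharacter

variable {S R K : Type*} [Ring S] [Ring R] [Field K] (φ : S →+* R) (χ : S →+* K)

/-- The class of `r ⊗ 1`. -/
def inducedClass : R →ₗ[R] InducedModule φ (CharModule χ) :=
  (balancedRelations φ (CharModule χ)).mkQ ∘ₗ
    LinearMap.toSpanSingleton R _ ((1 : R) ⊗ₜ[ℤ] (show CharModule χ from (1 : K)))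

theorem inducedClass_apply (r : R) : inducedClass φ χ r =
    Submodule.Quotient.mk (r ⊗ₜ[ℤ] (show CharModule χ from (1 : K))) := by
  change Submodule.Quotient.mk (r • ((1 : R) ⊗ₜ[ℤ] (show CharModule χ from (1 : K)))) = _
  rw [TensorProduct.smul_tmul', smul_eq_mul, mul_one]

theorem inducedClass_mul (r : R) (s : S) : inducedClass φ χ (r * φ s) =
    Submodule.Quotient.mk (r ⊗ₜ[ℤ] (show CharModule χ from χ s)) := by
  rw [inducedClass_apply, Submodule.Quotient.eq]
  refine Submodule.subset_span ⟨r, s, (show CharModule χ from (1 : K)), ?_⟩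
  congr 2
  exact (mul_one (χ s)).symm

/-- Surjectivity of χ lets any scalar κ = χ(s) be moved across the tensor sign into r φ(s), so the
induced module is cyclic. -/
theorem inducedClass_surjective (hχ : Function.Surjective χ) :
    Function.Surjective (inducedClass φ χ) := by
  intro d
  obtain ⟨t, rfl⟩ := Submodule.Quotient.mk_surjective _ d
  induction t using TensorProduct.induction_on with
  | zero => exact ⟨0, by rw [map_zero, Submodule.Quotient.mk_zero]⟩
  | add a b ha hb =>
    obtain ⟨r, hr⟩ := ha
    obtain ⟨s, hs⟩ := hb
    exact ⟨r + s, by rw [map_add, hr, hs, Submodule.Quotient.mk_add]⟩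
  | tmul r κ =>
    obtain ⟨s, hs⟩ := hχ κ
    exact ⟨r * φ s, by rw [inducedClass_mul, hs]⟩

theorem inducedClass_eq_zero (r : R) {s : S} (hs : χ s = 0) : inducedClass φ χ (r * φ s) = 0 := by
  rw [inducedClass_mul, hs]
  exact (congrArg _ (TensorProduct.tmul_zero _ r)).trans (Submodule.Quotient.mk_zero _)

/-- An additive functional that transforms by `χ` shows that the class of `1` is nonzero. -/
theorem inducedClass_one_ne_zero (Ψ : R →+ K) (hΨ : ∀ r s, Ψ (r * φ s) = χ s * Ψ r)
    (h1 : Ψ 1 ≠ 0) : inducedClass φ χ 1 ≠ 0 := by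
  let Φ : R ⊗[ℤ] CharModule χ →+ K :=
    TensorProduct.liftAddHom (R := ℤ) (N := K) (AddMonoidHom.mul.flip.comp Ψ) (by
      intro n r κ
      change κ * Ψ (n • r) = (n • κ) * Ψ r
      rw [map_zsmul, smul_mul_assoc, mul_smul_comm])
  have hΦ : ∀ (r : R) (κ : CharModule χ), Φ (r ⊗ₜ κ) = (show K from κ) * Ψ r :=
    fun r κ => rfl
  have key : ∀ t ∈ balancedRelations φ (CharModule χ), ∀ r : R, Φ (r • t) = 0 := by
    intro t ht
    induction ht using Submodule.span_induction with
    | mem t ht =>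
      obtain ⟨r', s, κ, rfl⟩ := ht
      intro r
      rw [smul_sub, TensorProduct.smul_tmul', TensorProduct.smul_tmul', map_sub, hΦ, hΦ, smul_eq_mul,
        smul_eq_mul, ← mul_assoc, hΨ]
      have h : ∀ a b c : K, a * (b * c) - b * a * c = 0 := fun a b c => by ring
      exact h κ (χ s) (Ψ (r * r'))
    | zero => simp
    | add a b _ _ ha hb =>
      intro r
      rw [smul_add, map_add, ha, hb, add_zero]
    | smul a b _ hb =>
      intro r
      rw [smul_smul]
      exact hb _
  intro h
  rw [inducedClass_apply, Submodule.Quotient.mk_eq_zero] at h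
  have h2 := key _ h 1
  rw [one_smul, hΦ] at h2
  exact h1 ((one_mul _).symm.trans h2)

end InducedCharacter

/-! ### Simplicity after inverting π -/

section BaseChange

variable {O : Type*} [CommRing O] {π : O} (K : Type*) [Field K] [Algebra O K]

theorem exists_pow_smul_eq_tmul {W : Type*} [AddCommGroup W] [Module O W]
    (hK : ∀ κ : K, ∃ (k : ℕ) (r : O), π ^ k • κ = algebraMap O K r) (t : K ⊗[O] W) :
    ∃ (k : ℕ) (w : W), π ^ k • t = 1 ⊗ₜ w := by
  induction t using TensorProduct.induction_on with
  | zero => exact ⟨0, 0, by simp⟩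
  | tmul κ w =>
    obtain ⟨k, r, h⟩ := hK κ
    refine ⟨k, r • w, ?_⟩
    rw [TensorProduct.smul_tmul', h, Algebra.algebraMap_eq_smul_one, TensorProduct.smul_tmul]
  | add a b ha hb =>
    obtain ⟨k, w, hw⟩ := ha
    obtain ⟨l, z, hz⟩ := hb
    refine ⟨k + l, π ^ l • w + π ^ k • z, ?_⟩
    rw [smul_add, TensorProduct.tmul_add, TensorProduct.tmul_smul, TensorProduct.tmul_smul, ← hw,
      ← hz, smul_smul, smul_smul, ← pow_add, ← pow_add, add_comm l]

/-- A criterion for the irreducibility of `R ⊗_S K` where `R = K ⊗ A` and `S = K ⊗ C`. -/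
theorem isSimpleModule_induced {A C : Type*} [Ring A] [Algebra O A] [Ring C] [Algebra O C]
    (hK : ∀ κ : K, ∃ (k : ℕ) (r : O), π ^ k • κ = algebraMap O K r) (hπ : algebraMap O K π ≠ 0)
    (F : C →ₐ[O] A) (X : C →ₐ[O] O) (l : A →ₗ[O] O) (hl : ∀ a c, l (a * F c) = X c * l a)
    (hl1 : l 1 = 1)
    (hA : ∀ a, a ∈ Ideal.span {a | ∃ c, X c = 0 ∧ a = F c} ∨
      ∃ (u : A) (k : ℕ), u * a - π ^ k • 1 ∈ Ideal.span {a | ∃ c, X c = 0 ∧ a = F c})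
    (φ : K ⊗[O] C →+* K ⊗[O] A) (hφ : ∀ a w, φ (a ⊗ₜ w) = a ⊗ₜ F w)
    (ψ : K ⊗[O] C →+* K) (hψ : ∀ a w, ψ (a ⊗ₜ w) = a * algebraMap O K (X w)) :
    IsSimpleModule (K ⊗[O] A) (InducedModule φ (CharModule ψ)) := by
  have hone : inducedClass φ ψ 1 ≠ 0 := by
    let Ψ : K ⊗[O] A →ₗ[K] K := LinearMap.liftBaseChange K (Algebra.linearMap O K ∘ₗ l)
    have hΨ : ∀ a w, Ψ (a ⊗ₜ w) = a * algebraMap O K (l w) :=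
      fun a w => LinearMap.liftBaseChange_tmul _ _ _ _
    refine inducedClass_one_ne_zero φ ψ Ψ.toAddMonoidHom (fun r s => ?_) ?_
    · change Ψ (r * φ s) = ψ s * Ψ r
      induction r using TensorProduct.induction_on with
      | zero => rw [zero_mul, map_zero, mul_zero]
      | add a b ha hb => rw [add_mul, map_add, map_add, mul_add, ha, hb]
      | tmul a w =>
        induction s using TensorProduct.induction_on with
        | zero => rw [map_zero, mul_zero, map_zero, map_zero, zero_mul]
        | add a b ha hb => rw [map_add, mul_add, map_add, map_add, add_mul, ha, hb]
        | tmul b z =>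
          rw [hφ, Algebra.TensorProduct.tmul_mul_tmul, hΨ, hΨ, hψ, hl, map_mul]
          ring
    · change Ψ (1 ⊗ₜ 1) ≠ 0
      rw [hΨ, hl1, map_one, mul_one]
      exact one_ne_zero
  have hψs : Function.Surjective ψ := fun κ => ⟨κ ⊗ₜ 1, by rw [hψ, map_one, map_one, mul_one]⟩
  have hkey : ∀ w ∈ Ideal.span {a | ∃ c, X c = 0 ∧ a = F c},
      inducedClass φ ψ (1 ⊗ₜ w) = 0 := by
    intro w hw
    induction hw using Submodule.span_induction with
    | mem w hw =>
      obtain ⟨c, hc, rfl⟩ := hw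
      rw [← hφ, ← one_mul (φ _)]
      refine inducedClass_eq_zero φ ψ _ ?_
      rw [hψ, hc, map_zero, mul_zero]
    | zero => rw [TensorProduct.tmul_zero, map_zero]
    | add a b _ _ ha hb => rw [TensorProduct.tmul_add, map_add, ha, hb, add_zero]
    | smul a b _ hb =>
      have e : (1 : K) ⊗ₜ[O] (a • b) = ((1 : K) ⊗ₜ[O] a) • ((1 : K) ⊗ₜ[O] b) := by
        rw [smul_eq_mul, smul_eq_mul, Algebra.TensorProduct.tmul_mul_tmul, one_mul]
      rw [e, map_smul, hb, smul_zero]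
  have hpow : ∀ k : ℕ, algebraMap O K (π ^ k) ≠ 0 := fun k => by
    rw [map_pow]
    exact pow_ne_zero k hπ
  have hinv : ∀ k : ℕ, ((algebraMap O K (π ^ k))⁻¹ ⊗ₜ[O] (1 : A)) * ((π ^ k : O) • 1) = 1 := by
    intro k
    rw [mul_smul_comm, mul_one, TensorProduct.smul_tmul', Algebra.smul_def,
      mul_inv_cancel₀ (hpow k)]
    rfl
  rw [isSimpleModule_iff_toSpanSingleton_surjective]
  refine ⟨⟨_, _, hone⟩, fun d hd => ?_⟩
  obtain ⟨t, rfl⟩ := inducedClass_surjective φ ψ hψs d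
  obtain ⟨k, w, hw⟩ := exists_pow_smul_eq_tmul K hK t
  have hw' : (π ^ k • (1 : K ⊗[O] A)) * t = 1 ⊗ₜ w := by rw [smul_mul_assoc, one_mul, hw]
  -- After clearing denominators d is represented by w in the integral algebra: either w lies in the
  -- left ideal and d = 0, or a multiple of w is a power of π modulo the ideal, and d generates.
  rcases hA w with h | ⟨u, m, h⟩
  · refine absurd ?_ hd
    have h2 : t = ((algebraMap O K (π ^ k))⁻¹ ⊗ₜ[O] (1 : A)) • ((1 : K) ⊗ₜ[O] w) := by
      rw [← hw', smul_eq_mul, ← mul_assoc, hinv, one_mul]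
    rw [h2, map_smul, hkey w h, smul_zero]
  · have h2 : inducedClass φ ψ (((1 : K) ⊗ₜ[O] u) * ((1 : K) ⊗ₜ[O] w)) =
        inducedClass φ ψ (π ^ m • 1) := by
      rw [← sub_eq_zero, ← map_sub, Algebra.TensorProduct.tmul_mul_tmul, one_mul, ← hkey _ h,
        TensorProduct.tmul_sub, TensorProduct.tmul_smul]
      rfl
    have h3 : ((((algebraMap O K (π ^ m))⁻¹ ⊗ₜ[O] (1 : A)) * ((1 : K) ⊗ₜ[O] u)) *
        (π ^ k • (1 : K ⊗[O] A))) • inducedClass φ ψ t = inducedClass φ ψ 1 := by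
      rw [← map_smul, smul_eq_mul, mul_assoc, hw', mul_assoc, ← smul_eq_mul, map_smul, h2,
        ← map_smul, smul_eq_mul, hinv]
    intro e
    obtain ⟨r, rfl⟩ := inducedClass_surjective φ ψ hψs e
    refine ⟨r * ((((algebraMap O K (π ^ m))⁻¹ ⊗ₜ[O] (1 : A)) * ((1 : K) ⊗ₜ[O] u)) *
        (π ^ k • (1 : K ⊗[O] A))), ?_⟩
    rw [LinearMap.toSpanSingleton_apply, mul_smul, h3, ← map_smul, smul_eq_mul, mul_one]

end BaseChange

/-! ### Orbit map of the generator on the completed enveloping algebra -/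

variable {O : Type*} [CommRing O] {π : O}
  {N M : Type*} [LieRing N] [LieAlgebra O N] [LieRing M] [LieAlgebra O M]
  {i : N →ₗ⁅O⁆ M} {f : N →ₗ⁅O⁆ O} {χ : M →ₗ[O] O}
  {V : Type*} [AddCommGroup V] [Module O V] {ρ : M →ₗ⁅O⁆ Module.End O V} {v : V}

open UniversalEnvelopingAlgebra (ι lift lift_ι_apply)

theorem lift_envelopingMap_eigen (hv : ∀ n, ρ (i n) v = f n • v)
    (u : UniversalEnvelopingAlgebra O N) :
    lift O ρ (envelopingMap i u) v = lift O f u • v := by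
  refine envelope_induction (P := fun u => lift O ρ (envelopingMap i u) v = lift O f u • v)
    (fun r => ?_) (fun m => ?_) (fun a b ha hb => ?_) (fun a b ha hb => ?_) u
  · simp only [AlgHom.commutes, Module.algebraMap_end_apply, Algebra.algebraMap_self_apply]
  · rw [envelopingMap_ι, lift_ι_apply, lift_ι_apply, hv]
  · rw [map_mul, map_mul, map_mul, Module.End.mul_apply, hb, map_smul, ha, smul_smul, mul_comm]
  · rw [map_add, map_add, map_add, LinearMap.add_apply, ha, hb, add_smul]

/-- Finite generation of the lattice replaces the generators m - χ(m) by a finite list, which allows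
the coefficients to be summed π-adically one generator at a time. -/
theorem exists_mem_charIdeal {s : ℕ} {n : Fin s → N} (hn : Submodule.span O (Set.range n) = ⊤)
    (hχ : ∀ n, χ (i n) = f n) {u : UniversalEnvelopingAlgebra O M}
    (hu : u ∈ charIdeal (Set.range i) χ ⊔ powIdeal π (UniversalEnvelopingAlgebra O M) 1) :
    ∃ (c : Fin s → UniversalEnvelopingAlgebra O M) (b : UniversalEnvelopingAlgebra O M),
      u = ∑ j, c j * (ι O (i (n j)) - algebraMap O _ (f (n j))) + π • b := by
  obtain ⟨a, ha, b, hb, rfl⟩ := Submodule.mem_sup.1 hu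
  obtain ⟨b, rfl⟩ := (mem_powIdeal π).1 hb
  suffices h : charIdeal (Set.range i) χ ≤ Submodule.span (UniversalEnvelopingAlgebra O M)
      (Set.range fun j => ι O (i (n j)) - algebraMap O _ (f (n j))) by
    obtain ⟨c, hc⟩ := (Submodule.mem_span_range_iff_exists_fun _).1 (h ha)
    exact ⟨c, b, by rw [← hc, pow_one]; rfl⟩
  refine Ideal.span_le.2 ?_
  rintro _ ⟨_, ⟨m, rfl⟩, rfl⟩
  obtain ⟨r, rfl⟩ := (Submodule.mem_span_range_iff_exists_fun O).1
    (hn ▸ Submodule.mem_top : m ∈ Submodule.span O (Set.range n))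
  rw [hχ, SetLike.mem_coe]
  simp only [map_sum, map_smul, smul_eq_mul, map_mul, ← Finset.sum_sub_distrib]
  refine sum_mem fun j _ => ?_
  rw [← Algebra.smul_def, ← smul_sub, Algebra.smul_def]
  exact Submodule.smul_mem _ (algebraMap O (UniversalEnvelopingAlgebra O M) (r j))
    (Submodule.subset_span ⟨j, rfl⟩)

theorem completionMap_toCompletion {A B : Type*} [Ring A] [Algebra O A] [Ring B] [Algebra O B]
    (F : A →ₐ[O] B) (a : A) :
    completionMap π F (toCompletion π A a) = toCompletion π B (F a) := rfl

theorem completionLift_toCompletion [IsAdicComplete (Ideal.span {π}) O] {A : Type*} [Ring A]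
    [Algebra O A] (F : A →ₐ[O] O) (a : A) : completionLift π F (toCompletion π A a) = F a := by
  refine IsHausdorff.eq_iff_smodEq (I := Ideal.span {π}) |>.2 fun n => ?_
  rw [smul_eq_mul, Ideal.mul_top, SModEq]
  exact IsAdicComplete.mk_liftRingHom (Ideal.span {π}) (completionToQuot π F)
    (completionToQuot_compat π F) n (toCompletion π A a)

/-- Density modulo π is iterated on the successive remainders; the algebra elements found this way
are the coefficients of a convergent series. -/
theorem orbitMap_surjective {A : Type*} [Ring A] [Algebra O A] (hV : PiComplete π V)
    (φ : A →ₐ[O] Module.End O V) (v : V) (hd : ∀ f : V, ∃ (a : A) (g : V), f = φ a v + π • g) :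
    Function.Surjective (orbitMap hV φ v) := by
  choose a g hag using hd
  intro f
  let F : ℕ → V := fun n => g^[n] f
  have hF : ∀ n, F n = φ (a (F n)) v + π • F (n + 1) := fun n => by
    rw [show F (n + 1) = g (F n) from Function.iterate_succ_apply' g n f]
    exact hag (F n)
  have key : ∀ n m, ∃ w, orbitMap hV φ v
      (completionSeries fun j => toCompletion π A (a (F (m + j)))) - F m = π ^ n • w := by
    intro n
    induction n with
    | zero => exact fun m => ⟨_, by rw [pow_zero, one_smul]⟩
    | succ n ih =>
      intro m
      obtain ⟨w, hw⟩ := ih (m + 1)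
      refine ⟨w, ?_⟩
      have h2 : (completionSeries fun j => toCompletion π A (a (F (m + j)))) =
          toCompletion π A (a (F m)) +
            π • completionSeries fun j => toCompletion π A (a (F (m + 1 + j))) := by
        rw [completionSeries_eq]
        simp only [add_zero, add_assoc, add_comm 1]
      have h3 := hF m
      rw [← sub_eq_iff_eq_add'] at h3
      rw [pow_succ', mul_smul, ← hw, h2, map_add, map_smul, orbitMap_toCompletion, smul_sub, ← h3]
      abel
  refine ⟨completionSeries fun j => toCompletion π A (a (F (0 + j))), ?_⟩
  rw [← sub_eq_zero]
  exact hV.separated _ fun n => key n 0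

theorem IsDixmierModel.mem_of_orbitMap_eq_zero [IsAdicComplete (Ideal.span {π}) O]
    (hN : (⊤ : Submodule O N).FG) (hχ : ∀ n, χ (i n) = f n)
    (hD : IsDixmierModel ρ π (Set.range i) χ v) (w : IntegralEnvelope π M)
    (hw : orbitMap hD.complete (lift O ρ) v w = 0) :
    w ∈ Ideal.span {a | ∃ c,
      completionLift π (lift O f) c = 0 ∧ a = completionMap π (envelopingMap i) c} := by
  obtain ⟨s, n, hn⟩ := Submodule.fg_iff_exists_fin_generating_family.1 hN
  obtain ⟨c, rfl⟩ := orbitMap_ker hD.complete (lift O ρ) v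
    (fun j => ι O (i (n j)) - algebraMap O _ (f (n j)))
    (fun j => by
      rw [map_sub, lift_ι_apply, AlgHom.commutes, LinearMap.sub_apply, hD.eigen _ ⟨_, rfl⟩, hχ,
        Module.algebraMap_end_apply, sub_self])
    (fun u hu => exists_mem_charIdeal hn hχ (hD.kernel u hu)) w hw
  refine sum_mem fun j _ => Ideal.mul_mem_left _ _ (Ideal.subset_span
    ⟨toCompletion π _ (ι O (n j) - algebraMap O _ (f (n j))), ?_, ?_⟩)
  · rw [completionLift_toCompletion, map_sub, lift_ι_apply, AlgHom.commutes]
    exact sub_self _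
  · rw [completionMap_toCompletion, map_sub (envelopingMap i), envelopingMap_ι, AlgHom.commutes]

/-- Writing the vector v + πz reached from w as (1 + πy)v and inverting 1 + πy gives an element of
the completion taking the vector of w to π^k v exactly. -/
theorem IsDixmierModel.exists_mul_sub_mem [IsAdicComplete (Ideal.span {π}) O]
    (hN : (⊤ : Submodule O N).FG) (hχ : ∀ n, χ (i n) = f n)
    (hD : IsDixmierModel ρ π (Set.range i) χ v) (w : IntegralEnvelope π M)
    (hw : orbitMap hD.complete (lift O ρ) v w ≠ 0) :
    ∃ (u : IntegralEnvelope π M) (k : ℕ), u * w - π ^ k • 1 ∈ Ideal.span {a | ∃ c,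
      completionLift π (lift O f) c = 0 ∧ a = completionMap π (envelopingMap i) c} := by
  obtain ⟨u, k, z, hu⟩ := hD.irreducible _ hw
  obtain ⟨y, rfl⟩ := orbitMap_surjective hD.complete (lift O ρ) v hD.dense z
  obtain ⟨q, hq⟩ := completion_exists_inverse y
  refine ⟨q * toCompletion π _ u, k, ?_⟩
  have e : q * toCompletion π _ u * w - π ^ k • 1 =
      q * (toCompletion π _ u * w - π ^ k • (1 + π • y)) := by
    rw [mul_sub, mul_smul_comm, hq, mul_assoc]
  rw [e]
  refine Ideal.mul_mem_left _ _ (hD.mem_of_orbitMap_eq_zero hN hχ _ ?_)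
  have h1 : orbitMap hD.complete (lift O ρ) v 1 = v := by
    rw [← map_one (toCompletion π (UniversalEnvelopingAlgebra O M)), orbitMap_toCompletion, map_one,
      Module.End.one_apply]
  rw [map_sub, orbitMap_toCompletion_mul, hu, map_smul, map_add, map_smul, h1, sub_self]

set_option maxHeartbeats 2000000 in
/-- The affinoid Dixmier module is irreducible if there is a model of it. -/
theorem isSimpleModule_of_model [IsAdicComplete (Ideal.span {π}) O]
    (K : Type*) [Field K] [Algebra O K]
    (hK : ∀ κ : K, ∃ (k : ℕ) (r : O), π ^ k • κ = algebraMap O K r) (hπ : algebraMap O K π ≠ 0)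
    (hN : (⊤ : Submodule O N).FG) (hχ : ∀ n, χ (i n) = f n)
    (hD : IsDixmierModel ρ π (Set.range i) χ v) :
    IsSimpleModule (AffinoidEnvelope π K M)
      (InducedModule (affinoidMap π K i : AffinoidEnvelope π K N →+* AffinoidEnvelope π K M)
        (CharModule (affinoidCharacter π K f : AffinoidEnvelope π K N →+* K))) := by
  obtain ⟨ε, hε⟩ := hD.functional
  have h1 : ∀ (a : K) (w : IntegralEnvelope π N),
      (affinoidMap π K i : AffinoidEnvelope π K N →+* AffinoidEnvelope π K M) (a ⊗ₜ[O] w) =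
        a ⊗ₜ[O] completionMap π (envelopingMap i) w :=
    fun a w => Algebra.TensorProduct.map_tmul _ _ _ _
  have h2 : ∀ (a : K) (w : IntegralEnvelope π N),
      (affinoidCharacter π K f : AffinoidEnvelope π K N →+* K) (a ⊗ₜ[O] w) =
        a * algebraMap O K (completionLift π (lift O f) w) :=
    fun a w => Algebra.TensorProduct.lift_tmul _ _ (fun _ _ => Commute.all _ _) _ _
  have h3 : ∀ (a : IntegralEnvelope π M) (c : IntegralEnvelope π N),
      (ε ∘ₗ orbitMap hD.complete (lift O ρ) v) (a * completionMap π (envelopingMap i) c) =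
        completionLift π (lift O f) c * (ε ∘ₗ orbitMap hD.complete (lift O ρ) v) a := fun a c => by
    rw [LinearMap.comp_apply, orbitMap_mul_completionMap hD.complete (lift O ρ) v (envelopingMap i)
      (lift O f) (lift_envelopingMap_eigen fun n => by rw [hD.eigen _ ⟨n, rfl⟩, hχ]), map_smul,
      smul_eq_mul, LinearMap.comp_apply]
  have h4 : (ε ∘ₗ orbitMap hD.complete (lift O ρ) v) (1 : IntegralEnvelope π M) = 1 := by
    rw [LinearMap.comp_apply, ← map_one (toCompletion π (UniversalEnvelopingAlgebra O M)),
      orbitMap_toCompletion, map_one, Module.End.one_apply, hε]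
  have h5 : ∀ w : IntegralEnvelope π M, w ∈ Ideal.span {a | ∃ c,
      completionLift π (lift O f) c = 0 ∧ a = completionMap π (envelopingMap i) c} ∨
      ∃ (u : IntegralEnvelope π M) (k : ℕ), u * w - π ^ k • 1 ∈ Ideal.span {a | ∃ c,
        completionLift π (lift O f) c = 0 ∧ a = completionMap π (envelopingMap i) c} := fun w => by
    by_cases hw : orbitMap hD.complete (lift O ρ) v w = 0
    · exact Or.inl (hD.mem_of_orbitMap_eq_zero hN hχ w hw)
    · exact Or.inr (hD.exists_mul_sub_mem hN hχ w hw)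
  have h6 := isSimpleModule_induced K hK hπ (completionMap π (envelopingMap i))
    (completionLift π (lift O f)) (ε ∘ₗ orbitMap hD.complete (lift O ρ) v) h3 h4 h5
    (affinoidMap π K i : AffinoidEnvelope π K N →+* AffinoidEnvelope π K M) h1
    (affinoidCharacter π K f : AffinoidEnvelope π K N →+* K) h2
  exact h6

end Irreducibility

/-! ### The valuation ring and its lattices -/

section ValRing

variable {p : ℕ} [Fact p.Prime] {K : Type*} [Field K] [Algebra ℚ_[p] K]
  [FiniteDimensional ℚ_[p] K] {π : valRing p K}

/-- Divisibility is comparison of norms. -/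
theorem valRing_dvd_or_dvd (a b : valRing p K) : a ∣ b ∨ b ∣ a := by
  let := spectralNorm.normedField ℚ_[p] K
  have key : ∀ a b : valRing p K, ‖(a : K)‖ ≤ ‖(b : K)‖ → b ∣ a := by
    intro a b h
    by_cases hb : (b : K) = 0
    · rw [hb, norm_zero, norm_le_zero_iff] at h
      rw [show a = 0 from Subtype.ext h]
      exact dvd_zero b
    · have hc : (b : K)⁻¹ * a ∈ valRing p K := by
        change ‖(b : K)⁻¹ * a‖ ≤ 1
        rw [norm_mul, norm_inv, inv_mul_le_one₀ (norm_pos_iff.2 hb)]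
        exact h
      exact ⟨⟨_, hc⟩, Subtype.ext (mul_inv_cancel_left₀ hb _).symm⟩
  rcases le_total ‖(a : K)‖ ‖(b : K)‖ with h | h
  · exact Or.inr (key a b h)
  · exact Or.inl (key b a h)

theorem valRing_isUnit_of_not_dvd (hπ : Irreducible π) {r : valRing p K} (h : ¬ π ∣ r) :
    IsUnit r := by
  obtain ⟨t, ht⟩ := (valRing_dvd_or_dvd π r).resolve_left h
  refine (hπ.isUnit_or_isUnit ht).resolve_right fun hu => h ?_
  rw [ht]
  exact hu.mul_right_dvd.2 dvd_rfl

theorem valRing_piComplete (hπ : Irreducible π) : PiComplete π (valRing p K) := by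
  have := isAdicComplete_valRing hπ
  have hmod : ∀ (n : ℕ) (x y : valRing p K),
      x ≡ y [SMOD (Ideal.span {π} ^ n • ⊤ : Ideal (valRing p K))] ↔ ∃ w, x - y = π ^ n • w := by
    intro n x y
    rw [smul_eq_mul, Ideal.mul_top, SModEq.sub_mem, Ideal.span_singleton_pow,
      Ideal.mem_span_singleton]
    rfl
  refine ⟨fun v h => ?_, fun v h => ?_, fun a => ?_⟩
  · exact (mul_eq_zero.1 h).resolve_left hπ.ne_zero
  · refine IsHausdorff.haus (I := Ideal.span {π}) inferInstance v fun n => (hmod n v 0).2 ?_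
    rw [sub_zero]
    exact h n
  · obtain ⟨l, hl⟩ := IsPrecomplete.prec (I := Ideal.span {π}) inferInstance
      (f := fun n => ∑ i ∈ Finset.range n, π ^ i • a i) (by
        intro m n h
        rw [hmod, ← Finset.sum_range_add_sum_Ico _ h, sub_add_cancel_left]
        refine ⟨-∑ i ∈ Finset.Ico m n, π ^ (i - m) • a i, ?_⟩
        rw [smul_neg, Finset.smul_sum]
        congr 1
        refine Finset.sum_congr rfl fun i hi => ?_
        rw [smul_smul, ← pow_add, Nat.add_sub_cancel' (Finset.mem_Ico.1 hi).1])
    refine ⟨l, fun n => ?_⟩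
    obtain ⟨w, hw⟩ := (hmod n _ _).1 (hl n)
    exact ⟨-w, by rw [smul_neg, ← hw, neg_sub]⟩

/-- Separatedness bounds the powers of π dividing r, and the quotient by the largest of them is a
unit. -/
theorem valRing_exists_unit_mul (hπ : Irreducible π) {r : valRing p K} (hr : r ≠ 0) :
    ∃ (s : (valRing p K)ˣ) (k : ℕ), s * r = π ^ k := by
  obtain ⟨n, hn⟩ : ∃ n, ¬ π ^ n ∣ r := by
    by_contra! h
    exact hr ((valRing_piComplete hπ).separated r h)
  obtain ⟨k, hk, hk'⟩ : ∃ k, π ^ k ∣ r ∧ ¬ π ^ (k + 1) ∣ r := by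
    by_contra! h
    refine hn ?_
    clear hn
    induction n with
    | zero => exact (pow_zero π).symm ▸ one_dvd r
    | succ n ih => exact h n ih
  obtain ⟨t, rfl⟩ := hk
  obtain ⟨u, rfl⟩ := valRing_isUnit_of_not_dvd hπ (r := t) fun ⟨q, hq⟩ =>
    hk' ⟨q, by rw [hq, pow_succ, mul_assoc]⟩
  exact ⟨u⁻¹, k, by rw [mul_comm (π ^ k), Units.inv_mul_cancel_left]⟩

theorem valRing_exists_pow_smul (hπ : Irreducible π) (κ : K) :
    ∃ (k : ℕ) (r : valRing p K), π ^ k • κ = algebraMap (valRing p K) K r := by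
  by_cases hκ : κ ∈ valRing p K
  · exact ⟨0, ⟨κ, hκ⟩, by rw [pow_zero, one_smul]; rfl⟩
  · let := spectralNorm.normedField ℚ_[p] K
    have hκ0 : κ ≠ 0 := fun h => hκ (h ▸ zero_mem _)
    have h1 : κ⁻¹ ∈ valRing p K := by
      change ‖κ⁻¹‖ ≤ 1
      rw [norm_inv]
      exact inv_le_one_of_one_le₀ (not_le.1 hκ).le
    obtain ⟨s, k, hs⟩ := valRing_exists_unit_mul hπ (r := ⟨κ⁻¹, h1⟩)
      fun h => inv_ne_zero hκ0 (congrArg Subtype.val h)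
    refine ⟨k, s, ?_⟩
    have h2 : ((π ^ k : valRing p K) : K) = (s : valRing p K) * κ⁻¹ :=
      (congrArg Subtype.val hs).symm
    change ((π ^ k : valRing p K) : K) * κ = (s : valRing p K)
    rw [h2, inv_mul_cancel_right₀ hκ0]

theorem valRing_charZero : CharZero (valRing p K) := by
  have : CharZero K := charZero_of_injective_algebraMap (algebraMap ℚ_[p] K).injective
  exact (valRing p K).subtype.charZero

/-- A separated lattice in a finite-dimensional space is finitely generated. -/
theorem fg_of_separated (hπ : Irreducible π) {W : Type*} [AddCommGroup W] [Module K W]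
    [FiniteDimensional K W] (N : Submodule (valRing p K) W)
    (hN : ∀ x : W, (∀ n : ℕ, ∃ y ∈ N, x = π ^ n • y) → x = 0) : N.FG := by
  have hO := valRing_piComplete hπ
  have hπ0 : (π : K) ≠ 0 := fun h => hπ.ne_zero (Subtype.ext h)
  have hinj : ∀ w w' : W, π • w = π • w' → w = w' := fun w w' h =>
    smul_right_injective W hπ0 h
  -- Families in N that are linearly independent in N/πN. Such a family is independent over K, since
  -- the coefficients of an integral relation are divisible by every power of π; so its length is
  -- bounded.
  let good : ℕ → Prop := fun s => ∃ e : Fin s → W, (∀ j, e j ∈ N) ∧ ∀ r : Fin s → valRing p K,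
    (∃ y ∈ N, ∑ j, r j • e j = π • y) → ∀ j, π ∣ r j
  have hgood : ∀ s, good s → s ≤ Module.finrank K W := by
    rintro s ⟨e, heN, he⟩
    have h1 : ∀ n (r : Fin s → valRing p K), ∑ j, r j • e j = 0 → ∀ j, ∃ w, r j = π ^ n • w := by
      intro n
      induction n with
      | zero => exact fun r _ j => ⟨r j, by rw [pow_zero, one_smul]⟩
      | succ n ih =>
        intro r hr j
        choose q hq using he r ⟨0, zero_mem _, by rw [hr, smul_zero]⟩
        have h2 : ∑ j, q j • e j = 0 := hinj _ _ (by
          rw [smul_zero, ← hr, Finset.smul_sum]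
          exact Finset.sum_congr rfl fun j _ => by rw [hq j, mul_smul])
        obtain ⟨w, hw⟩ := ih q h2 j
        exact ⟨w, by rw [hq j, hw, pow_succ', mul_smul]; rfl⟩
    have h3 : LinearIndependent K e := by
      rw [Fintype.linearIndependent_iff]
      intro κ hκ j
      choose k r hr using fun j => valRing_exists_pow_smul hπ (κ j)
      have h4 : ∀ j, ((π ^ (∑ l, k l - k j) * r j : valRing p K) : K) =
          ((π ^ (∑ l, k l) : valRing p K) : K) * κ j := fun j => by
        have h5 : k j ≤ ∑ l, k l := Finset.single_le_sum (fun _ _ => Nat.zero_le _)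
          (Finset.mem_univ j)
        have h6 : ((π ^ k j : valRing p K) : K) * κ j = r j := hr j
        rw [Subring.coe_mul, ← h6, ← mul_assoc, ← Subring.coe_mul, ← pow_add,
          Nat.sub_add_cancel h5]
      have h7 : ∑ j, (π ^ (∑ l, k l - k j) * r j) • e j = 0 := by
        have h8 : ∀ j, (π ^ (∑ l, k l - k j) * r j) • e j =
            ((π ^ (∑ l, k l) : valRing p K) : K) • κ j • e j := fun j => by
          rw [smul_smul, ← h4]
          rfl
        rw [Finset.sum_congr rfl fun j _ => h8 j, ← Finset.smul_sum, hκ, smul_zero]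
      have h9 := h4 j
      rw [hO.separated _ fun n => h1 n _ h7 j, Subring.coe_zero, Subring.coe_pow] at h9
      exact (mul_eq_zero.1 h9.symm).resolve_left (pow_ne_zero _ hπ0)
    simpa using h3.fintype_card_le_finrank
  obtain ⟨s, ⟨e, heN, he⟩, hs⟩ : ∃ s, good s ∧ ¬ good (s + 1) := by
    by_contra! h
    have h0 : good 0 := ⟨Fin.elim0, fun j => j.elim0, fun _ _ j => j.elim0⟩
    have h1 : ∀ s, good s := fun s => Nat.rec h0 (fun s hs => h s hs) s
    exact absurd (hgood _ (h1 (Module.finrank K W + 1))) (by omega)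
  -- For a family of maximal length, adjoining l creates a relation modulo π. The coefficient of l
  -- is prime to π, hence a unit, and can be divided out.
  have step : ∀ l : N, ∃ (c : Fin s → valRing p K) (y : N), (l : W) = ∑ j, c j • e j + π • (y : W) := by
    rintro ⟨l, hl⟩
    have h1 : ¬ ∀ r : Fin (s + 1) → valRing p K,
        (∃ y ∈ N, ∑ j, r j • (Fin.cons l e : Fin (s + 1) → W) j = π • y) → ∀ j, π ∣ r j :=
      fun h => hs ⟨Fin.cons l e, fun j => Fin.cases hl heN j, h⟩
    push Not at h1
    obtain ⟨r, ⟨y, hy, hr⟩, j, hj⟩ := h1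
    simp only [Fin.sum_univ_succ, Fin.cons_zero, Fin.cons_succ] at hr
    have h2 : ¬ π ∣ r 0 := by
      rintro ⟨q, hq⟩
      have h3 := he (fun j => r j.succ) ⟨y - q • l, sub_mem hy (N.smul_mem _ hl), by
        rw [smul_sub, ← hr, hq, mul_smul]
        abel⟩
      exact hj (Fin.cases ⟨q, hq⟩ h3 j)
    obtain ⟨u, hu⟩ := valRing_isUnit_of_not_dvd hπ h2
    refine ⟨fun j => -((u⁻¹ : (valRing p K)ˣ) : valRing p K) * r j.succ,
      ⟨((u⁻¹ : (valRing p K)ˣ) : valRing p K) • y, N.smul_mem _ hy⟩, ?_⟩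
    have h4 : l = ((u⁻¹ : (valRing p K)ˣ) : valRing p K) • r 0 • l := by
      rw [← hu, smul_smul, Units.inv_mul, one_smul]
    have h5 : r 0 • l = π • y - ∑ j : Fin s, r j.succ • e j := eq_sub_of_add_eq hr
    change l = _
    rw [h4, h5]
    simp only [neg_mul, neg_smul, Finset.sum_neg_distrib, smul_sub, Finset.smul_sum, mul_smul]
    rw [smul_comm π]
    abel
  choose c y hcy using step
  refine Submodule.fg_iff_exists_fin_generating_family.2 ⟨s, e, le_antisymm ?_ ?_⟩
  · rw [Submodule.span_le]
    rintro _ ⟨j, rfl⟩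
    exact heN j
  intro l hl
  let F : ℕ → N := fun n => y^[n] ⟨l, hl⟩
  have hF : ∀ n, (F n : W) = ∑ j, c (F n) j • e j + π • (F (n + 1) : W) := fun n => by
    rw [show F (n + 1) = y (F n) from Function.iterate_succ_apply' y n _]
    exact hcy _
  choose R hR using fun j => hO.series fun n => c (F n) j
  have key : ∀ n, l = ∑ j, (∑ m ∈ Finset.range n, π ^ m • c (F m) j) • e j + π ^ n • (F n : W) := by
    intro n
    induction n with
    | zero => simp [F]
    | succ n ih =>
      simp only [Finset.sum_range_succ, add_smul, Finset.sum_add_distrib]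
      have h5 : π ^ n • (F n : W) = ∑ j, (π ^ n • c (F n) j) • e j + π ^ (n + 1) • (F (n + 1) : W) := by
        rw [hF n, smul_add, Finset.smul_sum, smul_smul, ← pow_succ]
        simp only [smul_assoc]
      rw [add_assoc, ← h5]
      exact ih
  have h1 : l = ∑ j, R j • e j := by
    rw [← sub_eq_zero]
    refine hN _ fun n => ?_
    choose w hw using fun j => hR j n
    refine ⟨(F n : W) - ∑ j, w j • e j, sub_mem (F n).2 (sum_mem fun j _ => N.smul_mem _ (heN j)), ?_⟩
    have h2 : ∀ j, R j • e j = (∑ m ∈ Finset.range n, π ^ m • c (F m) j) • e j +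
        π ^ n • w j • e j := fun j => by
      rw [← sub_eq_iff_eq_add', ← sub_smul, hw j, smul_assoc]
    rw [Finset.sum_congr rfl fun j _ => h2 j, Finset.sum_add_distrib, smul_sub, Finset.smul_sum]
    nth_rewrite 1 [key n]
    abel
  rw [h1]
  exact sum_mem fun j _ => Submodule.smul_mem _ _ (Submodule.subset_span ⟨j, rfl⟩)

end ValRing

/-! ### Reduction to ideals of corank one -/

section Nilpotent

variable {k : Type*} [Field k]

/-- If `lam` does not vanish on brackets of a nilpotent Lie algebra `h`, there is an element `y`
that is central modulo an ideal in the kernel of `lam`, up to elements that are themselves central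
modulo this ideal, but is not itself central modulo it. -/
theorem exists_second_center {h : Type*} [LieRing h] [LieAlgebra k h] [LieRing.IsNilpotent h]
    (lam : Module.Dual k h) {a b : h} (hab : lam ⁅a, b⁆ ≠ 0) :
    ∃ (A : LieIdeal k h) (y : h), (∀ a ∈ A, lam a = 0) ∧ (∃ x : h, lam ⁅x, y⁆ ≠ 0) ∧
      (∀ u w : h, ⁅w, ⁅u, y⁆⁆ ∈ A) ∧ ∀ u : h, lam ⁅u, y⁆ = 0 → ⁅u, y⁆ ∈ A := by
  -- The largest ideal inside ker λ: a sum of ideals on which λ vanishes.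
  let A : LieIdeal k h := sSup {I | ∀ a ∈ I, lam a = 0}
  have hA : ∀ a ∈ A, lam a = 0 := by
    have h1 : (sSup {I : LieIdeal k h | ∀ a ∈ I, lam a = 0}).toSubmodule ≤ LinearMap.ker lam := by
      rw [LieSubmodule.sSup_toSubmodule_eq_iSup]
      exact iSup₂_le fun I hI a ha => hI a ha
    exact fun a ha => h1 ha
  -- The preimage of the centre of h/A. Its intersection with ker λ is an ideal, hence contained in
  -- A by maximality.
  let C : LieIdeal k h :=
    { carrier := {z | ∀ u, ⁅u, z⁆ ∈ A}
      add_mem' := fun {a b} ha hb u => by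
        rw [lie_add]
        exact add_mem (ha u) (hb u)
      zero_mem' := fun u => by
        rw [lie_zero]
        exact zero_mem A
      smul_mem' := fun r a ha u => by
        rw [lie_smul]
        exact A.smul_mem r (ha u)
      lie_mem := fun {w z} hz u => A.lie_mem (hz w) }
  have hC : ∀ z ∈ C, lam z = 0 → z ∈ A := by
    let I : LieIdeal k h :=
      { carrier := {z | z ∈ C ∧ lam z = 0}
        add_mem' := fun {a b} ha hb => ⟨add_mem ha.1 hb.1, by rw [map_add, ha.2, hb.2, add_zero]⟩
        zero_mem' := ⟨zero_mem C, map_zero lam⟩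
        smul_mem' := fun r a ha => ⟨C.smul_mem r ha.1, by rw [map_smul, ha.2, smul_zero]⟩
        lie_mem := fun {w z} hz => ⟨C.lie_mem hz.1, hA _ (hz.1 w)⟩ }
    have hI : I ≤ A := le_sSup fun a ha => ha.2
    exact fun z hz h0 => hI ⟨hz, h0⟩
  obtain ⟨n, hn⟩ := LieModule.IsNilpotent.nilpotent k h h
  -- The last term of the lower central series not contained in C supplies y. At m = 0 this uses C ≠
  -- h: if b were in C, then λ([a, b]) would vanish.
  obtain ⟨m, hm, hm'⟩ : ∃ m, ¬ LieModule.lowerCentralSeries k h h m ≤ C ∧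
      LieModule.lowerCentralSeries k h h (m + 1) ≤ C := by
    by_contra! hcon
    have h0 : ¬ LieModule.lowerCentralSeries k h h 0 ≤ C := fun hle =>
      hab (hA _ (hle (LieSubmodule.mem_top b) a))
    have h1 : ∀ m, ¬ LieModule.lowerCentralSeries k h h m ≤ C :=
      fun m => Nat.rec h0 (fun m hm => hcon m hm) m
    exact h1 n (hn ▸ bot_le)
  obtain ⟨y, hy, hyC⟩ := SetLike.not_le_iff_exists.1 hm
  have hyu : ∀ u, ⁅u, y⁆ ∈ C := fun u => hm' (by
    rw [LieModule.lowerCentralSeries_succ]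
    exact LieSubmodule.lie_mem_lie (LieSubmodule.mem_top u) hy)
  refine ⟨A, y, hA, ?_, fun u w => hyu u w, fun u h0 => hC _ (hyu u) h0⟩
  by_contra! hcon
  exact hyC fun u => hC _ (hyu u) (hcon u)

/-- The version of `exists_second_center` for a subalgebra. -/
theorem exists_second_center_subalgebra {g : Type*} [LieRing g] [LieAlgebra k g]
    [LieRing.IsNilpotent g] (lam : Module.Dual k g) (h : LieSubalgebra k g) {a b : g} (ha : a ∈ h)
    (hb : b ∈ h) (hab : lam ⁅a, b⁆ ≠ 0) :
    ∃ (A : Submodule k g) (y : g), y ∈ h ∧ (∀ a ∈ A, lam a = 0) ∧ (∀ u ∈ h, ∀ a ∈ A, ⁅u, a⁆ ∈ A) ∧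
      (∃ x ∈ h, lam ⁅x, y⁆ ≠ 0) ∧ (∀ u ∈ h, ∀ w ∈ h, ⁅w, ⁅u, y⁆⁆ ∈ A) ∧
      ∀ u ∈ h, lam ⁅u, y⁆ = 0 → ⁅u, y⁆ ∈ A := by
  have : LieRing.IsNilpotent h :=
    Function.Injective.lieAlgebra_isNilpotent (R := k) (f := h.incl) Subtype.val_injective
  obtain ⟨A, y, h1, ⟨x, h2⟩, h3, h4⟩ := exists_second_center (h := h)
    (lam ∘ₗ (h.toSubmodule.subtype)) (a := ⟨a, ha⟩) (b := ⟨b, hb⟩) hab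
  refine ⟨A.toSubmodule.map h.toSubmodule.subtype, y, y.2, ?_, ?_, ⟨x, x.2, h2⟩, ?_, ?_⟩
  · rintro _ ⟨a, ha, rfl⟩
    exact h1 a ha
  · rintro u hu _ ⟨a, ha, rfl⟩
    exact ⟨⁅(⟨u, hu⟩ : h), a⁆, A.lie_mem ha, rfl⟩
  · exact fun u hu w hw => ⟨_, h3 ⟨u, hu⟩ ⟨w, hw⟩, rfl⟩
  · exact fun u hu h0 => ⟨_, h4 ⟨u, hu⟩ h0, rfl⟩

end Nilpotent

/-! ### Existence of polarisations with irreducible affinoid Dixmier module -/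

section Existence

universe u

variable {p : ℕ} [Fact p.Prime] {K : Type u} [Field K] [Algebra ℚ_[p] K]
  [FiniteDimensional ℚ_[p] K] {π : valRing p K} {g : Type*} [LieRing g] [LieAlgebra K g]

/-- The restriction of a linear form to a lattice on which it is integral. -/
def latticeForm (lam : Module.Dual K g) (M : LieSubalgebra (valRing p K) g)
    (hM : ∀ x ∈ M, lam x ∈ valRing p K) : M →ₗ[valRing p K] valRing p K where
  toFun x := ⟨lam x, hM x x.2⟩
  map_add' x y := Subtype.ext (map_add lam (x : g) (y : g))
  map_smul' c x := Subtype.ext (map_smul lam (c : K) (x : g))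

/-- There is a model of the Dixmier module of the lattice `M` for the subalgebra `b`. -/
def HasDixmierModel (π : valRing p K) (lam : Module.Dual K g) (M : LieSubalgebra (valRing p K) g)
    (hM : ∀ x ∈ M, lam x ∈ valRing p K) (b : LieSubalgebra K g) : Prop :=
  ∃ (V : Type u) (_ : AddCommGroup V) (_ : Module (valRing p K) V)
    (ρ : M →ₗ⁅valRing p K⁆ Module.End (valRing p K) V) (v : V),
    IsDixmierModel ρ π {m : M | (m : g) ∈ b} (latticeForm lam M hM) v

theorem valRing_exists_mul (hπ : Irreducible π) (r : valRing p K) (hr : r ≠ 0) :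
    ∃ (s : valRing p K) (k : ℕ), s * r = π ^ k := by
  obtain ⟨s, k, h⟩ := valRing_exists_unit_mul hπ hr
  exact ⟨s, k, h⟩

theorem hasDixmierModel_of_character (hπ : Irreducible π) (lam : Module.Dual K g)
    (M : LieSubalgebra (valRing p K) g) (hM : ∀ x ∈ M, lam x ∈ valRing p K) (b : LieSubalgebra K g)
    (hMb : ∀ x ∈ M, x ∈ b) (hb : ∀ x ∈ b, ∀ y ∈ b, lam ⁅x, y⁆ = 0) :
    HasDixmierModel π lam M hM b := by
  obtain ⟨ρ, hρ⟩ := exists_scalar_model (χ := latticeForm lam M hM) (valRing_piComplete hπ)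
    (valRing_exists_mul hπ) fun x y => Subtype.ext (hb x (hMb x x.2) y (hMb y y.2))
  refine ⟨valRing p K, inferInstance, inferInstance, ρ, 1, ?_⟩
  rwa [show {m : M | (m : g) ∈ b} = Set.univ from Set.eq_univ_of_forall fun m => hMb m m.2]

theorem IsLieLattice.exists_pow_smul_mem (hπ : Irreducible π) {L : LieSubalgebra (valRing p K) g}
    (hL : IsLieLattice π L) (z : g) : ∃ k : ℕ, π ^ k • z ∈ L := by
  have hz : z ∈ Submodule.span K (L : Set g) := hL.spans ▸ Submodule.mem_top
  induction hz using Submodule.span_induction with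
  | mem z hz => exact ⟨0, by rwa [pow_zero, one_smul]⟩
  | zero => exact ⟨0, by rw [smul_zero]; exact zero_mem L⟩
  | add a b _ _ ha hb =>
    obtain ⟨k, hk⟩ := ha
    obtain ⟨l, hl⟩ := hb
    refine ⟨k + l, ?_⟩
    rw [smul_add]
    refine add_mem ?_ ?_
    · rw [add_comm, pow_add, mul_smul]
      exact L.smul_mem _ hk
    · rw [pow_add, mul_smul]
      exact L.smul_mem _ hl
  | smul κ a _ ha =>
    obtain ⟨k, hk⟩ := ha
    obtain ⟨m, r, hr⟩ := valRing_exists_pow_smul hπ κ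
    refine ⟨m + k, ?_⟩
    have h1 : ((π ^ m : valRing p K) : K) * κ = r := hr
    have h2 : π ^ (m + k) • κ • a = r • π ^ k • a := by
      change ((π ^ (m + k) : valRing p K) : K) • κ • a =
        (r : K) • ((π ^ k : valRing p K) : K) • a
      rw [smul_smul, smul_smul, ← h1, pow_add, Subring.coe_mul]
      congr 1
      ring
    rw [h2]
    exact L.smul_mem r hk

/-- A nonzero integral functional on a lattice attains a value dividing all other values. -/
theorem exists_generating_value (hπ : Irreducible π) {M : Type*} (ν : M → valRing p K)
    (hν : ∃ x, ν x ≠ 0) : ∃ x, ν x ≠ 0 ∧ ∀ u, ν x ∣ ν u := by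
  classical
  have h0 : ∃ k, ∃ x, ∃ s : (valRing p K)ˣ, s * ν x = π ^ k := by
    obtain ⟨x, hx⟩ := hν
    obtain ⟨s, k, h⟩ := valRing_exists_unit_mul hπ hx
    exact ⟨k, x, s, h⟩
  obtain ⟨x, s, hs⟩ := Nat.find_spec h0
  refine ⟨x, fun h => ?_, fun u => ?_⟩
  · rw [h, mul_zero] at hs
    exact pow_ne_zero _ hπ.ne_zero hs.symm
  · by_cases hu : ν u = 0
    · rw [hu]
      exact dvd_zero _
    · obtain ⟨t, l, ht⟩ := valRing_exists_unit_mul hπ hu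
      have h1 : Nat.find h0 ≤ l := Nat.find_min' h0 ⟨u, t, ht⟩
      have h2 := pow_dvd_pow π h1
      rw [← hs, ← ht] at h2
      exact (t.isUnit.dvd_mul_left).1 ((s.isUnit.mul_left_dvd).1 h2)

/-- The complement of an ideal of corank one in a lattice. -/
theorem exists_isSplitExtension {M M' : LieSubalgebra (valRing p K) g} (hle : M' ≤ M) {x : g}
    (hx : x ∈ M) (hxM' : ∀ u ∈ M', ⁅x, u⁆ ∈ M') (ν : g →ₗ[K] K)
    (hν : ∀ u ∈ M, u ∈ M' ↔ ν u = 0) (hνx : ν x ≠ 0)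
    (hdiv : ∀ u ∈ M, ν u * (ν x)⁻¹ ∈ valRing p K) :
    ∃ (δ : LieDerivation (valRing p K) M' M') (μ : M →ₗ[valRing p K] valRing p K)
      (η : M →ₗ[valRing p K] M'), (∀ u : M', (δ u : g) = ⁅x, (u : g)⁆) ∧
      IsSplitExtension (LieSubalgebra.inclusion hle) (⟨x, hx⟩ : M) δ μ η := by
  let μ : M →ₗ[valRing p K] valRing p K :=
    { toFun := fun u => ⟨ν u * (ν x)⁻¹, hdiv u u.2⟩
      map_add' := fun u w => Subtype.ext (by
        change ν ((u : g) + w) * _ = _ * _ + _ * _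
        rw [map_add, add_mul])
      map_smul' := fun r u => Subtype.ext (by
        change ν ((r : K) • (u : g)) * _ = (r : K) * (_ * _)
        rw [map_smul, smul_eq_mul, mul_assoc]) }
  have hμ : ∀ u : M, (μ u : K) = ν u * (ν x)⁻¹ := fun u => rfl
  have hη : ∀ u : M, (u : g) - (μ u : K) • x ∈ M' := fun u => by
    refine (hν _ (sub_mem u.2 (M.smul_mem (μ u) hx))).2 ?_
    change ν ((u : g) - (μ u : K) • x) = 0
    rw [map_sub, map_smul, hμ, smul_eq_mul, inv_mul_cancel_right₀ hνx, sub_self]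
  let η : M →ₗ[valRing p K] M' :=
    { toFun := fun u => ⟨u - (μ u : K) • x, hη u⟩
      map_add' := fun u w => Subtype.ext (by
        change (u : g) + w - (μ (u + w) : K) • x = (u - (μ u : K) • x) + (w - (μ w : K) • x)
        rw [map_add, Subring.coe_add, add_smul]
        abel)
      map_smul' := fun r u => Subtype.ext (by
        change (r : K) • (u : g) - (μ (r • u) : K) • x = (r : K) • (u - (μ u : K) • x)
        rw [map_smul, smul_eq_mul, Subring.coe_mul, smul_sub, mul_smul]) }
  let δ : LieDerivation (valRing p K) M' M' :=
    { toFun := fun u => ⟨⁅x, (u : g)⁆, hxM' u u.2⟩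
      map_add' := fun u w => Subtype.ext (lie_add x (u : g) w)
      map_smul' := fun r u => Subtype.ext (lie_smul (r : K) x (u : g))
      leibniz' := fun u w => Subtype.ext (by
        change ⁅x, ⁅(u : g), (w : g)⁆⁆ = ⁅(u : g), ⁅x, (w : g)⁆⁆ - ⁅(w : g), ⁅x, (u : g)⁆⁆
        rw [leibniz_lie x (u : g) (w : g), ← lie_skew (⁅x, (u : g)⁆ : g) (w : g)]
        abel) }
  refine ⟨δ, μ, η, fun u => rfl, ?_, ?_, ?_, ?_, ?_⟩
  · exact fun u w h => Subtype.ext (congrArg (Subtype.val : M → g) h)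
  · exact fun u => rfl
  · exact fun u => Subtype.ext (add_sub_cancel ((μ u : K) • x) (u : g)).symm
  · intro u
    refine Subtype.ext ?_
    change ν (u : g) * (ν x)⁻¹ = 0
    rw [(hν _ (hle u.2)).1 u.2, zero_mul]
  · exact Subtype.ext (mul_inv_cancel₀ hνx)

end Existence

/-! ### Construction of the polarisation by induction on dimension -/

section Polarisation

universe u

variable {p : ℕ} [Fact p.Prime] {K : Type u} [Field K] [Algebra ℚ_[p] K]
  [FiniteDimensional ℚ_[p] K] {π : valRing p K} {g : Type*} [LieRing g] [LieAlgebra K g]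

/-- The induction step: passing from the ideal `h' = {u : lam [u, y] = 0}` to `h`. -/
theorem HasDixmierModel.induced [LieRing.IsNilpotent g] (hπ : Irreducible π) (lam : Module.Dual K g)
    {h h' : LieSubalgebra K g} {A : Submodule K g} {y : g} (hyh : y ∈ h)
    (hAlam : ∀ a ∈ A, lam a = 0) (hA : ∀ u ∈ h, ∀ a ∈ A, ⁅u, a⁆ ∈ A)
    (hy2 : ∀ u ∈ h, ∀ w ∈ h, ⁅w, ⁅u, y⁆⁆ ∈ A) (hy1 : ∀ u ∈ h, lam ⁅u, y⁆ = 0 → ⁅u, y⁆ ∈ A)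
    (hh' : ∀ u, u ∈ h' ↔ u ∈ h ∧ lam ⁅u, y⁆ = 0)
    (hlie : ∀ u ∈ h, ∀ w ∈ h, ⁅u, w⁆ ∈ h')
    {M M' : LieSubalgebra (valRing p K) g} (hM : ∀ x ∈ M, lam x ∈ valRing p K)
    (hM'l : ∀ x ∈ M', lam x ∈ valRing p K)
    (hMh : ∀ x ∈ M, x ∈ h) (hM' : ∀ x, x ∈ M' ↔ x ∈ M ∧ x ∈ h') (hyM : y ∈ M)
    (hx : ∃ x ∈ M, lam ⁅x, y⁆ ≠ 0) {b : LieSubalgebra K g} (hb : b ≤ h')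
    (hpol : ∀ u ∈ h', (∀ v ∈ b, lam ⁅u, v⁆ = 0) → u ∈ b)
    (hD : HasDixmierModel π lam M' hM'l b) : HasDixmierModel π lam M hM b := by
  obtain ⟨V, _, _, ρ, v, hD⟩ := hD
  -- Least valuation of λ([x, y]) makes Ox a complement of M' in M integrally, not merely over K.
  obtain ⟨⟨x, hxM⟩, hx0, hxdiv⟩ := exists_generating_value hπ
    (fun u : M => (⟨lam ⁅(u : g), y⁆, hM _ (M.lie_mem u.2 hyM)⟩ : valRing p K)) (by
      obtain ⟨x, hxM, hx⟩ := hx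
      exact ⟨⟨x, hxM⟩, fun h => hx (congrArg Subtype.val h)⟩)
  have hxy : lam ⁅x, y⁆ ≠ 0 := fun h => hx0 (Subtype.ext h)
  have hyy : y ∈ h' := (hh' y).2 ⟨hyh, by rw [lie_self, map_zero]⟩
  have hle : M' ≤ M := fun u hu => ((hM' u).1 hu).1
  let ν : g →ₗ[K] K := lam ∘ₗ
    { toFun := fun u => ⁅u, y⁆
      map_add' := fun a b => add_lie a b y
      map_smul' := fun r a => smul_lie r a y }
  obtain ⟨δ, μ, η, hδ, hS⟩ := exists_isSplitExtension hle hxM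
    (fun u hu => (hM' _).2 ⟨M.lie_mem hxM (hle hu), hlie _ (hMh x hxM) _ (hMh u (hle hu))⟩) ν
    (fun u hu => by
      rw [hM', hh']
      exact ⟨fun h => h.2.2, fun h => ⟨hu, hMh u hu, h⟩⟩) hxy
    (fun u hu => by
      obtain ⟨c, hc⟩ := hxdiv ⟨u, hu⟩
      have h1 : lam ⁅u, y⁆ = lam ⁅x, y⁆ * c := congrArg Subtype.val hc
      change lam ⁅u, y⁆ * (lam ⁅x, y⁆)⁻¹ ∈ _
      rw [h1, mul_comm, inv_mul_cancel_left₀ hxy]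
      exact c.2)
  have hδk : ∀ (k : ℕ) (u : M'), (δ^[k] u : g) = (LieModule.toEnd K g g x ^ k) u := by
    intro k
    induction k with
    | zero => exact fun u => rfl
    | succ k ih =>
      intro u
      rw [Function.iterate_succ_apply', hδ, ih, pow_succ']
      rfl
  obtain ⟨N, hN⟩ := LieModule.exists_forall_pow_toEnd_eq_zero K g g
  -- Raising the nilpotency bound by 2 lets the terms of order 0 and 1 be split off the sum giving
  -- the action of y.
  have hN2 : ∀ u : M', δ^[N + 2] u = 0 := fun u => Subtype.ext (by
    rw [hδk, pow_add, hN, zero_mul]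
    rfl)
  -- Elements of M' that are central modulo A in h'. Maximality puts them in b, so they act on V by
  -- scalars. Both y and [x, y] belong to E, and the further iterates of ad x on y lie in A, where λ
  -- vanishes.
  let E : Set M' := {e | ∀ u ∈ h', ⁅(e : g), u⁆ ∈ A}
  have hMh' : ∀ u : M', (u : g) ∈ h' := fun u => ((hM' u).1 u.2).2
  have hh'h : ∀ u ∈ h', u ∈ h := fun u hu => ((hh' u).1 hu).1
  have hscal : ∀ e ∈ E, ∀ f, ρ e f = latticeForm lam M' hM'l e • f := by
    refine fun e he f => hD.scalar E (fun e he m => ⟨fun u hu => ?_, ?_⟩) (fun e he => ?_) he f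
    · rw [← lie_skew]
      exact A.neg_mem (hA u (hh'h u hu) _ (he m (hMh' m)))
    · exact Subtype.ext (hAlam _ (he m (hMh' m)))
    · exact hpol e (hMh' e) fun w hw => hAlam _ (he w (hb hw))
  have hAE : ∀ e : M', (e : g) ∈ A → e ∈ E := fun e he u hu => by
    rw [← lie_skew]
    exact A.neg_mem (hA u (hh'h u hu) _ he)
  let y' : M' := ⟨y, (hM' y).2 ⟨hyM, hyy⟩⟩
  have hδA : ∀ k, (δ^[k + 2] y' : g) ∈ A := by
    intro k
    induction k with
    | zero =>
      rw [zero_add, Function.iterate_succ_apply', hδ, Function.iterate_one, hδ]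
      exact hy2 x (hMh x hxM) x (hMh x hxM)
    | succ k ih =>
      rw [show k + 1 + 2 = (k + 2) + 1 by omega, Function.iterate_succ_apply', hδ]
      exact hA x (hMh x hxM) _ ih
  have := valRing_charZero (p := p) (K := K)
  refine ⟨nullSequences π V, inferInstance, inferInstance, nullHom hS ρ hN2, nullSingle 0 v,
    hD.induced hS (valRing_exists_mul hπ) (fun m => ?_) (fun u => rfl) hN2 (y := y')
      (b := latticeForm lam M' hM'l y') (c := latticeForm lam M' hM'l (δ y')) ?_ ?_ ?_ ?_⟩
  · constructor
    · exact fun hm => ⟨⟨m, (hM' m).2 ⟨m.2, hb hm⟩⟩, hm, rfl⟩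
    · rintro ⟨u, hu, rfl⟩
      exact hu
  · intro h
    have h1 : lam (δ y' : g) = 0 := congrArg Subtype.val h
    rw [hδ] at h1
    exact hxy h1
  · refine hscal y' fun u hu => ?_
    change ⁅y, u⁆ ∈ A
    rw [← lie_skew]
    exact A.neg_mem (hy1 u (hh'h u hu) ((hh' u).1 hu).2)
  · refine hscal _ fun u hu => ?_
    rw [hδ, ← lie_skew]
    exact A.neg_mem (hy2 x (hMh x hxM) u (hh'h u hu))
  · intro k f
    rw [hscal _ (hAE _ (hδA k)), show latticeForm lam M' hM'l (δ^[k + 2] y') = 0 from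
      Subtype.ext (hAlam _ (hδA k)), zero_smul]

/-- Every integral linear form has a polarisation with a model of the Dixmier module. -/
theorem exists_polarisation [FiniteDimensional K g] [LieRing.IsNilpotent g] (hπ : Irreducible π)
    {L : LieSubalgebra (valRing p K) g} (hL : IsLieLattice π L) (lam : Module.Dual K g)
    (hlam : ∀ x ∈ L, lam x ∈ valRing p K) (n : ℕ) : ∀ h : LieSubalgebra K g,
    Module.finrank K h < n → ∀ M : LieSubalgebra (valRing p K) g,
    (hM : ∀ x, x ∈ M ↔ x ∈ h ∧ x ∈ L) → ∃ b ≤ h,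
      (∀ u ∈ h, (∀ v ∈ b, lam ⁅u, v⁆ = 0) ↔ u ∈ b) ∧
      HasDixmierModel π lam M (fun x hx => hlam x ((hM x).1 hx).2) b := by
  induction n with
  | zero => exact fun h hn => absurd hn (Nat.not_lt_zero _)
  | succ n ih =>
    intro h hn M hM
    by_cases hab : ∀ a ∈ h, ∀ b ∈ h, lam ⁅a, b⁆ = 0
    · exact ⟨h, le_rfl, fun u hu => ⟨fun _ => hu, fun _ v hv => hab u hu v hv⟩,
        hasDixmierModel_of_character hπ lam M _ h (fun x hx => ((hM x).1 hx).1) hab⟩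
    push Not at hab
    obtain ⟨a, ha, b, hb, hab⟩ := hab
    obtain ⟨A, z, hz, hAlam, hA, ⟨w, hwh, hw⟩, hz2, hz1⟩ :=
      exists_second_center_subalgebra lam h ha hb hab
    obtain ⟨k, hk⟩ := hL.exists_pow_smul_mem hπ z
    obtain ⟨l, hl⟩ := hL.exists_pow_smul_mem hπ w
    have hπk : ∀ k : ℕ, ((π ^ k : valRing p K) : K) ≠ 0 := fun k h0 =>
      pow_ne_zero k hπ.ne_zero (Subtype.ext h0)
    -- The element z is rescaled into the lattice; c • z plays the role of y.
    obtain ⟨c, hc, hck⟩ : ∃ c : K, c ≠ 0 ∧ c • z ∈ L := ⟨_, hπk k, hk⟩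
    obtain ⟨d, hd, hdl⟩ : ∃ d : K, d ≠ 0 ∧ d • w ∈ L := ⟨_, hπk l, hl⟩
    have hyc : ∀ u : g, lam ⁅u, c • z⁆ = c * lam ⁅u, z⁆ := fun u => by
      rw [lie_smul c u z, map_smul, smul_eq_mul]
    -- By the Jacobi identity [[u, u'], y] is a difference of double brackets lying in A. So h'
    -- contains [h, h] and is an ideal of h.
    have hlie : ∀ u ∈ h, ∀ u' ∈ h, ⁅u, u'⁆ ∈ h ∧ lam ⁅⁅u, u'⁆, c • z⁆ = 0 := fun u hu u' hu' => by
      refine ⟨h.lie_mem hu hu', ?_⟩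
      rw [hyc, lie_lie, map_sub, hAlam _ (hz2 u' hu' u hu), hAlam _ (hz2 u hu u' hu'), sub_self,
        mul_zero]
    let h' : LieSubalgebra K g :=
      { carrier := {u | u ∈ h ∧ lam ⁅u, c • z⁆ = 0}
        add_mem' := fun {u u'} hu hu' => ⟨add_mem hu.1 hu'.1, by
          rw [add_lie, map_add, hu.2, hu'.2, add_zero]⟩
        zero_mem' := ⟨zero_mem h, by rw [zero_lie, map_zero]⟩
        smul_mem' := fun r u hu => ⟨h.smul_mem r hu.1, by
          rw [smul_lie, map_smul, hu.2, smul_zero]⟩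
        lie_mem' := fun {u u'} hu hu' => hlie u hu.1 u' hu'.1 }
    have hlt : Module.finrank K h' < Module.finrank K h := by
      refine Submodule.finrank_lt_finrank_of_lt (s := h'.toSubmodule) (t := h.toSubmodule) ?_
      refine lt_of_le_of_ne (fun u hu => hu.1) fun heq => ?_
      have h1 : w ∈ h'.toSubmodule := heq ▸ hwh
      have h2 := h1.2
      rw [hyc] at h2
      exact (mul_ne_zero hc hw) h2
    obtain ⟨b, hbh', hpol, hD⟩ := ih h' (by omega) (latticeInter h' L) fun x => Iff.rfl
    have hyh : c • z ∈ h := h.smul_mem c hz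
    have hyM : c • z ∈ M := (hM _).2 ⟨hyh, hck⟩
    have hy1 : ∀ u ∈ h, lam ⁅u, c • z⁆ = 0 → ⁅u, c • z⁆ ∈ A := fun u hu h0 => by
      rw [hyc] at h0
      rw [lie_smul]
      exact A.smul_mem c (hz1 u hu ((mul_eq_zero.1 h0).resolve_left hc))
    have hy2 : ∀ u ∈ h, ∀ u' ∈ h, ⁅u', ⁅u, c • z⁆⁆ ∈ A := fun u hu u' hu' => by
      rw [lie_smul, lie_smul]
      exact A.smul_mem c (hz2 u hu u' hu')
    -- By definition of h', y is orthogonal to h' under λ([·, ·]), hence belongs to b by maximality.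
    have hyb : c • z ∈ b := by
      refine (hpol _ ⟨hyh, by rw [lie_self, map_zero]⟩).1 fun u hu => ?_
      rw [← lie_skew, map_neg, (hbh' hu).2, neg_zero]
    refine ⟨b, fun u hu => (hbh' hu).1, fun u hu => ⟨fun h0 => ?_, fun hub => ?_⟩, ?_⟩
    -- Orthogonality to b includes orthogonality to y, which already forces u ∈ h'.
    · exact (hpol u ⟨hu, h0 _ hyb⟩).1 h0
    · exact (hpol u (hbh' hub)).2 hub
    · refine hD.induced hπ lam hyh hAlam hA hy2 hy1 (fun u => Iff.rfl) hlie _ _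
        (fun x hx => ((hM x).1 hx).1) (fun x => ?_) hyM ⟨d • w, (hM _).2 ⟨h.smul_mem d hwh, hdl⟩, ?_⟩
        hbh' fun u hu h0 => (hpol u hu).1 h0
      · rw [hM]
        exact ⟨fun hx => ⟨⟨hx.1.1, hx.2⟩, hx.1⟩, fun hx => ⟨hx.2, hx.1.2⟩⟩
      · rw [hyc, smul_lie, map_smul, smul_eq_mul]
        exact mul_ne_zero hc (mul_ne_zero hd hw)

end Polarisation

end AffinoidDixmier
end

theorem mainTheorem3 (p : ℕ) [Fact p.Prime]
    (K : Type*) [Field K] [Algebra ℚ_[p] K] [FiniteDimensional ℚ_[p] K]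
    (π : AffinoidDixmier.valRing p K) (hπ : Irreducible π)
    (g : Type*) [LieRing g] [LieAlgebra K g] [FiniteDimensional K g] [LieRing.IsNilpotent g]
    (L : LieSubalgebra (AffinoidDixmier.valRing p K) g) (hL : AffinoidDixmier.IsLieLattice π L)
    (lam : Module.Dual K g) (hlam : ∀ x ∈ L, lam x ∈ AffinoidDixmier.valRing p K) :
    ∃ (b : LieSubalgebra K g) (hb : AffinoidDixmier.IsPolarisation lam b),
      IsSimpleModule (AffinoidDixmier.AffinoidEnvelope π K L)
        (AffinoidDixmier.AffinoidDixmierModule L lam hlam b hb hπ) := by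
  obtain ⟨b, -, hpol, V, _, _, ρ, v, hD⟩ := AffinoidDixmier.exists_polarisation hπ hL lam hlam _ ⊤
    (Nat.lt_succ_self _) L fun x => ⟨fun hx => ⟨LieSubalgebra.mem_top x, hx⟩, fun hx => hx.2⟩
  have hnil : LieRing.IsNilpotent b :=
    Function.Injective.lieAlgebra_isNilpotent (R := K) (f := b.incl) Subtype.val_injective
  have hb : AffinoidDixmier.IsPolarisation lam b :=
    ⟨inferInstance, fun u => hpol u (LieSubalgebra.mem_top u)⟩
  refine ⟨b, hb, ?_⟩
  have := AffinoidDixmier.isAdicComplete_valRing hπ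
  -- The lattice b ∩ L inherits separatedness from L, hence is finitely generated, as the passage to
  -- the completed algebra requires.
  have hfg := AffinoidDixmier.fg_of_separated hπ
    (AffinoidDixmier.latticeInter b L).toSubmodule fun x hx => hL.separated x fun n => by
      obtain ⟨y, hy, h⟩ := hx n
      exact ⟨y, hy.2, h⟩
  have hrange : {m : L | (m : g) ∈ b} =
      Set.range (LieSubalgebra.inclusion (AffinoidDixmier.latticeInter_le b L)) := by
    ext m
    constructor
    · exact fun hm => ⟨⟨m, hm, m.2⟩, rfl⟩
    · rintro ⟨u, rfl⟩
      exact u.2.1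
  rw [hrange] at hD
  exact AffinoidDixmier.isSimpleModule_of_model
    (f := AffinoidDixmier.restrictCharacter L lam hlam b hb) K
    (AffinoidDixmier.valRing_exists_pow_smul hπ)
    (fun h0 => hπ.ne_zero (Subtype.ext h0)) ((Submodule.fg_top _).2 hfg) (fun n => rfl) hD
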